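/- **Setting.** Let $\mathcal J=\mathbb{Q}[\tau,z_k,\bar z_k\mid k\ge1]\,\{v,u\}[q]\,[[\varepsilon]]$ with $q=e^u$: power series in $\varepsilon$ whose coefficients are polynomials in the constants $\tau,z_k,\bar z_k$, the jet variables $v^{(k)},u^{(k)}$ ($k\ge0$) and $q$, with the derivation $\partial$ given by $\partial v^{(k)}=v^{(k+1)}$, $\partial u^{(k)}=u^{(k+1)}$, $\partial q=q\,\partial u$, and $\partial=0$ on $\varepsilon,\tau,z_k,\bar z_k$. Write $\mathsf E=e^{\varepsilon\partial}$ and $\mathsf P=\varepsilon\partial/(\mathsf E^{1/2}-\mathsf E^{-1/2})$. Difference operators $\sum_k p_k\Lambda^k$ ($p_k\in\mathcal J$, $p_k=0$ for $k\gg0$) are multiplied by $a\Lambda^i\cdot b\Lambda^j=(\mathsf E^{-j/2}a)(\mathsf E^{i/2}b)\Lambda^{i+j}$. The Lax operator of the equivariant Toda lattice is the unique difference operator $L=\Lambda+v+\sum_{k\ge2}a_k\Lambda^{1-k}$ such that, with $K=\Lambda+v+q\Lambda^{-1}$ and $L^n=\sum_k p_k(n)\Lambda^k$, $$\varepsilon^{-1}[K,L]=\tau\,\partial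 L ,\qquad p_{-1}(n)-q\,p_1(n)-\tau\,\mathsf P\,p_0(n)=z_n\quad(n>0).$$ The involution $f\mapsto\bar f$ of $\mathcal J$ is the $\varepsilon$-linear, $\varepsilon$-adically continuous ring homomorphism that commutes with $\partial$ and satisfies $\bar u=u$, $\bar q=q$, $\bar v=v-\tau\mathsf P u$, $\bar\tau=-\tau$ and $z_k\leftrightarrow\bar z_k$. Let $\int f\,dx$ be the class of $f$ in the space of functionals $\mathcal J/\partial\mathcal J$, on which the involution also acts. For $n\ge0$ put $$h_n=\frac1{n+1}\int p_0(n+1)\,dx,\qquad H_n=h_n-\tau h_{n-1}+\sum_{k=1}^{n-1}z_k\,h_{n-k-1}\qquad(h_{-1}=0),$$ and let $\bar H_n$ be the conjugate of $H_n$, and $\bar p_k(n)$ the conjugate of $p_k(n)$. The variational derivatives $\delta_v,\delta_u:\mathcal J/\partial\mathcal J\to\mathcal J$ are $$\delta_v\!\int f\,dx=\sum_{k\ge0}(-\partial)^k\frac{\partial f}{\partial v^{(k)}},\qquad \delta_u\!\int f\,dx=\sum_{k\ge0}(-\partial)^k\frac{\partial f}{\partial u^{(k)}},$$ where $q=e^u$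 is differentiated as a function of $u$. **Corollary.** For all $n\ge0$, $$\delta_vH_n=p_0(n),\qquad \delta_uH_n=q\,p_1(n),\qquad \delta_v\bar H_n=\bar p_0(n),\qquad \delta_u\bar H_n=q\,\bar p_1(n)-\tau\,\mathsf P\,\bar p_0(n).$$ -/

import Mathlib

open scoped PowerSeries

namespace EqToda

noncomputable section Operators

open Finset.HasAntidiagonal

/-! ### Difference operators over a topologically free differential algebra

`R` is a differential algebra over `ℚ` with derivation `d`, and the differential algebra over
`ℚ⟦ε⟧` is `R⟦ε⟧`, that is `PowerSeries R` with `ε = PowerSeries.X`; `d` acts on coefficients. -/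

variable {R : Type*} [CommRing R] [Algebra ℚ R] (d : Derivation ℚ R R)

/-- The derivation `∂` of `R⟦ε⟧`, acting coefficientwise by `d`. -/
def der (f : R⟦X⟧) : R⟦X⟧ := PowerSeries.mk fun n => d (PowerSeries.coeff n f)

/-- For a series `φ(t) = ∑ φᵢ tⁱ` over `ℚ`, the operator `φ(ε∂) = ∑ φᵢ εⁱ ∂ⁱ` on `R⟦ε⟧`. -/
def op (φ : ℚ⟦X⟧) : R⟦X⟧ →+ R⟦X⟧ where
  toFun f := PowerSeries.mk fun n => ∑ p ∈ antidiagonal n,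
    PowerSeries.coeff p.1 φ • (d^[p.1] (PowerSeries.coeff p.2 f))
  map_zero' := by
    ext n
    simp [iterate_map_zero]
  map_add' f g := by
    ext n
    simp [iterate_map_add, smul_add, Finset.sum_add_distrib]

/-- The series `exp (s t)`. -/
def expSeries (s : ℚ) : ℚ⟦X⟧ := PowerSeries.rescale s (PowerSeries.exp ℚ)

/-- The series `sinh(t/2)/(t/2) = ∑ₘ t²ᵐ / (4ᵐ (2m+1)!)`. -/
def sinhcSeries : ℚ⟦X⟧ :=
  PowerSeries.mk fun n => if Even n then (1 / 2 : ℚ) ^ n / (n + 1).factorial else 0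

/-- The operator `P = ε∂ / (E^{1/2} - E^{-1/2}) = (ε∂/2) / sinh(ε∂/2)`, where `E = exp(ε∂)`. -/
def opP : R⟦X⟧ →+ R⟦X⟧ := op d sinhcSeries⁻¹

theorem coeff_op (φ : ℚ⟦X⟧) (f : R⟦X⟧) (n : ℕ) :
    PowerSeries.coeff n (op d φ f) = ∑ p ∈ antidiagonal n,
      PowerSeries.coeff p.1 φ • (d^[p.1] (PowerSeries.coeff p.2 f)) := by
  simp [op]

theorem iter_rat_smul (n : ℕ) (c : ℚ) (x : R) : d^[n] (c • x) = c • d^[n] x := by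
  induction n with
  | zero => rfl
  | succ n ih => rw [Function.iterate_succ_apply', ih, Function.iterate_succ_apply', map_rat_smul]

theorem iter_sum {ι : Type*} (n : ℕ) (s : Finset ι) (g : ι → R) :
    d^[n] (∑ i ∈ s, g i) = ∑ i ∈ s, d^[n] (g i) := by
  induction n with
  | zero => rfl
  | succ n ih => simp [Function.iterate_succ_apply', ih, map_sum]

theorem op_mul (φ ψ : ℚ⟦X⟧) (f : R⟦X⟧) : op d (φ * ψ) f = op d φ (op d ψ f) := by
  ext n
  simp only [coeff_op, PowerSeries.coeff_mul, Finset.sum_smul, iter_sum, Finset.smul_sum,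
    iter_rat_smul, smul_smul, ← Function.iterate_add_apply]
  rw [Finset.sum_sigma', Finset.sum_sigma']
  refine Finset.sum_nbij' (fun x => ⟨(x.2.1, x.2.2 + x.1.2), (x.2.2, x.1.2)⟩)
    (fun x => ⟨(x.1.1 + x.2.1, x.2.2), (x.1.1, x.2.1)⟩) ?_ ?_ ?_ ?_ ?_
  · rintro ⟨⟨a, b⟩, ⟨i, j⟩⟩ h
    simp at h ⊢
    omega
  · rintro ⟨⟨a, b⟩, ⟨i, j⟩⟩ h
    simp at h ⊢
    omega
  · rintro ⟨⟨a, b⟩, ⟨i, j⟩⟩ h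
    simp at h ⊢
    omega
  · rintro ⟨⟨a, b⟩, ⟨i, j⟩⟩ h
    simp at h ⊢
    omega
  · rintro ⟨⟨a, b⟩, ⟨i, j⟩⟩ h
    simp at h ⊢
    rw [← h.2]

theorem op_one (f : R⟦X⟧) : op d 1 f = f := by
  ext n
  rw [coeff_op, Finset.sum_eq_single (0, n)]
  · simp
  · rintro ⟨a, b⟩ h hne
    have : a ≠ 0 := by
      rintro rfl
      simp at h
      exact hne (by simp [h])
    simp [PowerSeries.coeff_one, this]
  · simp

theorem op_add (φ ψ : ℚ⟦X⟧) (f : R⟦X⟧) : op d (φ + ψ) f = op d φ f + op d ψ f := by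
  ext n
  simp [coeff_op, add_smul, Finset.sum_add_distrib]

theorem op_X (f : R⟦X⟧) : op d PowerSeries.X f = PowerSeries.X * der d f := by
  ext n
  rw [coeff_op]
  cases n with
  | zero => simp
  | succ n =>
    rw [PowerSeries.coeff_succ_X_mul, Finset.sum_eq_single (1, n)]
    · simp [der]
    · rintro ⟨a, b⟩ h hne
      have : a ≠ 1 := by
        rintro rfl
        simp at h
        exact hne (by simp; omega)
      simp [PowerSeries.coeff_X, this]
    · simp [add_comm]

theorem expSeries_add (s t : ℚ) : expSeries s * expSeries t = expSeries (s + t) :=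
  PowerSeries.exp_mul_exp_eq_exp_add s t

theorem expSeries_zero : expSeries 0 = 1 := by
  ext n
  cases n <;> simp [expSeries, PowerSeries.coeff_one]

theorem coeff_expSeries (s : ℚ) (n : ℕ) :
    PowerSeries.coeff n (expSeries s) = s ^ n / n.factorial := by
  simp [expSeries, PowerSeries.coeff_rescale, PowerSeries.coeff_exp, div_eq_mul_inv]

theorem X_mul_sinhcSeries :
    PowerSeries.X * sinhcSeries = expSeries (1 / 2) - expSeries (-1 / 2) := by
  ext n
  rw [map_sub, coeff_expSeries, coeff_expSeries]
  cases n with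
  | zero => simp
  | succ n =>
    rw [PowerSeries.coeff_succ_X_mul, sinhcSeries, PowerSeries.coeff_mk]
    rcases Nat.even_or_odd n with h | h
    · have h' : Odd (n + 1) := h.add_one
      rw [if_pos h, neg_div, h'.neg_pow]
      ring
    · have h' : Even (n + 1) := h.add_one
      rw [if_neg (Nat.not_even_iff_odd.mpr h), neg_div, h'.neg_pow]
      ring

theorem sinhcSeries_mul_inv : sinhcSeries * sinhcSeries⁻¹ = 1 := by
  apply PowerSeries.mul_inv_cancel
  simp [sinhcSeries, ← PowerSeries.coeff_zero_eq_constantCoeff_apply]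

theorem iter_mul (n : ℕ) (x y : R) :
    d^[n] (x * y) = ∑ p ∈ antidiagonal n, n.choose p.1 • (d^[p.1] x * d^[p.2] y) := by
  induction n with
  | zero => simp
  | succ n ih =>
    rw [Finset.sum_antidiagonal_choose_succ_nsmul (fun i j => d^[i] x * d^[j] y) n]
    simp only [Function.iterate_succ_apply', ih, map_sum, map_nsmul, Derivation.leibniz,
      smul_eq_mul, smul_add, Finset.sum_add_distrib, add_right_inj]
    refine Finset.sum_congr rfl fun ⟨i, j⟩ hij => ?_
    rw [n.choose_symm_of_eq_add (mem_antidiagonal.1 hij).symm, mul_comm]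

/-- The ring homomorphism `R → R⟦ε⟧`, `x ↦ exp(s ε∂) x`. -/
def taylor (s : ℚ) : R →+* R⟦X⟧ where
  toFun x := PowerSeries.mk fun n => (s ^ n / n.factorial : ℚ) • d^[n] x
  map_zero' := by
    ext n
    simp [iterate_map_zero]
  map_add' x y := by
    ext n
    simp [iterate_map_add]
  map_one' := by
    ext n
    cases n with
    | zero => simp
    | succ n => simp [PowerSeries.coeff_one, iterate_map_zero]
  map_mul' x y := by
    ext n
    simp only [PowerSeries.coeff_mk, PowerSeries.coeff_mul, iter_mul, Finset.smul_sum]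
    refine Finset.sum_congr rfl fun ⟨i, j⟩ hij => ?_
    have hij' : i + j = n := mem_antidiagonal.1 hij
    subst hij'
    rw [smul_mul_smul_comm, ← Nat.cast_smul_eq_nsmul ℚ, smul_smul]
    congr 1
    rw [Nat.cast_add_choose, pow_add]
    have h1 : ((i + j).factorial : ℚ) ≠ 0 := by positivity
    have h2 : (i.factorial : ℚ) ≠ 0 := by positivity
    have h3 : (j.factorial : ℚ) ≠ 0 := by positivity
    field_simp

/-- The extension of a ring homomorphism `R → S⟦ε⟧` to `R⟦ε⟧ → S⟦ε⟧`, by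
`∑ fₘ εᵐ ↦ ∑ φ(fₘ) εᵐ`. -/
def extendHom {S : Type*} [CommRing S] (φ : R →+* S⟦X⟧) : R⟦X⟧ →+* S⟦X⟧ where
  toFun f := PowerSeries.mk fun n => ∑ p ∈ antidiagonal n,
    PowerSeries.coeff p.1 (φ (PowerSeries.coeff p.2 f))
  map_zero' := by
    ext n
    simp
  map_add' f g := by
    ext n
    simp [Finset.sum_add_distrib]
  map_one' := by
    ext n
    rw [PowerSeries.coeff_mk, Finset.sum_eq_single (n, 0)]
    · simp
    · rintro ⟨a, b⟩ h hne
      have : b ≠ 0 := by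
        rintro rfl
        simp at h
        exact hne (by simp [h])
      simp [PowerSeries.coeff_one, this]
    · simp
  map_mul' f g := by
    ext n
    simp only [PowerSeries.coeff_mk, PowerSeries.coeff_mul, map_sum, map_mul, Finset.sum_mul_sum]
    simp only [Finset.sum_sigma']
    refine Finset.sum_nbij'
      (fun x => ⟨(x.2.2.1 + x.2.1.1, x.2.2.2 + x.2.1.2), ⟨(x.2.2.1, x.2.1.1), (x.2.2.2, x.2.1.2)⟩⟩)
      (fun x => ⟨(x.2.1.1 + x.2.2.1, x.2.1.2 + x.2.2.2),
        ⟨(x.2.1.2, x.2.2.2), (x.2.1.1, x.2.2.1)⟩⟩) ?_ ?_ ?_ ?_ ?_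
    · rintro ⟨⟨a, b⟩, ⟨⟨i, j⟩, ⟨k, l⟩⟩⟩ h
      simp at h ⊢
      omega
    · rintro ⟨⟨a, b⟩, ⟨⟨i, j⟩, ⟨k, l⟩⟩⟩ h
      simp at h ⊢
      omega
    · rintro ⟨⟨a, b⟩, ⟨⟨i, j⟩, ⟨k, l⟩⟩⟩ h
      simp at h ⊢
      omega
    · rintro ⟨⟨a, b⟩, ⟨⟨i, j⟩, ⟨k, l⟩⟩⟩ h
      simp at h ⊢
      omega
    · rintro ⟨⟨a, b⟩, ⟨⟨i, j⟩, ⟨k, l⟩⟩⟩ h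
      rfl

/-- The automorphism `E^{k/2} = exp(k ε∂/2)` of `R⟦ε⟧`. -/
def halfShift (k : ℤ) : R⟦X⟧ →+* R⟦X⟧ := extendHom (taylor d (k / 2))

theorem halfShift_eq_op (k : ℤ) (f : R⟦X⟧) : halfShift d k f = op d (expSeries (k / 2)) f := by
  ext n
  simp [halfShift, extendHom, taylor, coeff_op, coeff_expSeries]

theorem halfShift_halfShift (k l : ℤ) (f : R⟦X⟧) :
    halfShift d k (halfShift d l f) = halfShift d (k + l) f := by
  rw [halfShift_eq_op, halfShift_eq_op, halfShift_eq_op, ← op_mul, expSeries_add]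
  push_cast
  rw [add_div]

theorem halfShift_zero (f : R⟦X⟧) : halfShift d 0 f = f := by
  rw [halfShift_eq_op]
  simp [expSeries_zero, op_one]

theorem halfShift_sub_opP (f : R⟦X⟧) :
    halfShift d 1 (opP d f) - halfShift d (-1) (opP d f) = PowerSeries.X * der d f := by
  have h : expSeries (1 / 2) = PowerSeries.X * sinhcSeries + expSeries (-1 / 2) := by
    rw [X_mul_sinhcSeries]
    ring
  rw [halfShift_eq_op, halfShift_eq_op]
  push_cast
  rw [h, op_add, add_sub_cancel_right, opP, ← op_mul, mul_assoc, sinhcSeries_mul_inv, mul_one,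
    op_X]

/-! ### The algebra of difference operators -/

/-- The difference operators `∑ pₖ Λᵏ` with `pₖ ∈ R⟦ε⟧` and `pₖ = 0` for `k ≫ 0`. -/
@[ext]
structure DiffOp (d : Derivation ℚ R R) where
  coeff : ℤ → R⟦X⟧
  bdd : ∃ N : ℤ, ∀ k, N < k → coeff k = 0

namespace DiffOp

variable {d}

instance : Zero (DiffOp d) := ⟨⟨0, 0, fun _ _ => rfl⟩⟩

instance : Add (DiffOp d) := ⟨fun A B => ⟨A.coeff + B.coeff, by
  obtain ⟨N, hN⟩ := A.bdd
  obtain ⟨M, hM⟩ := B.bdd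
  refine ⟨max N M, fun k hk => ?_⟩
  rw [max_lt_iff] at hk
  simp [hN k hk.1, hM k hk.2]⟩⟩

instance : Neg (DiffOp d) := ⟨fun A => ⟨-A.coeff, by
  obtain ⟨N, hN⟩ := A.bdd
  exact ⟨N, fun k hk => by simp [hN k hk]⟩⟩⟩

/-- The operator `a Λⁱ`. -/
def single (i : ℤ) (a : R⟦X⟧) : DiffOp d :=
  ⟨fun k => if k = i then a else 0, i, fun k hk => if_neg (by omega)⟩

instance : One (DiffOp d) := ⟨single 0 1⟩

/-- The terms `(E^{-j/2} aᵢ)(E^{i/2} bⱼ)`, with `i + j = k`, of the coefficient of `Λᵏ` in a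
product. -/
def mulTerm (A B : DiffOp d) (k i : ℤ) : R⟦X⟧ :=
  halfShift d (-(k - i)) (A.coeff i) * halfShift d i (B.coeff (k - i))

theorem mulTerm_support {A B : DiffOp d} {N M : ℤ} (hA : ∀ k, N < k → A.coeff k = 0)
    (hB : ∀ k, M < k → B.coeff k = 0) (k : ℤ) :
    Function.support (mulTerm A B k) ⊆ Set.Icc (k - M) N := by
  intro i hi
  rw [Function.mem_support, mulTerm] at hi
  constructor
  · by_contra h
    exact hi (by rw [hB _ (by omega)]; simp)
  · by_contra h
    exact hi (by rw [hA _ (by omega)]; simp)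

/-- The product
`(∑ aᵢ Λⁱ)(∑ bⱼ Λʲ) = ∑ₖ (∑_{i+j=k} (E^{-j/2} aᵢ)(E^{i/2} bⱼ)) Λᵏ`; the inner sums are finite. -/
instance : Mul (DiffOp d) := ⟨fun A B => ⟨fun k => ∑ᶠ i, mulTerm A B k i, by
  obtain ⟨N, hN⟩ := A.bdd
  obtain ⟨M, hM⟩ := B.bdd
  refine ⟨N + M, fun k hk => finsum_eq_zero_of_forall_eq_zero fun i => ?_⟩
  by_contra h
  have := mulTerm_support hN hM k h
  rw [Set.mem_Icc] at this
  omega⟩⟩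

@[simp] theorem coeff_zero (k : ℤ) : (0 : DiffOp d).coeff k = 0 := rfl
@[simp] theorem coeff_add (A B : DiffOp d) (k : ℤ) :
    (A + B).coeff k = A.coeff k + B.coeff k := rfl
@[simp] theorem coeff_neg (A : DiffOp d) (k : ℤ) : (-A).coeff k = -A.coeff k := rfl
theorem coeff_single (i : ℤ) (a : R⟦X⟧) (k : ℤ) :
    (single i a : DiffOp d).coeff k = if k = i then a else 0 := rfl
theorem coeff_one (k : ℤ) : (1 : DiffOp d).coeff k = if k = 0 then 1 else 0 := rfl
theorem coeff_mul (A B : DiffOp d) (k : ℤ) : (A * B).coeff k = ∑ᶠ i, mulTerm A B k i := rfl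

theorem coeff_mul_eq_sum {A B : DiffOp d} {N M : ℤ} (hA : ∀ k, N < k → A.coeff k = 0)
    (hB : ∀ k, M < k → B.coeff k = 0) (k : ℤ) {s : Finset ℤ} (hs : Finset.Icc (k - M) N ⊆ s) :
    (A * B).coeff k = ∑ i ∈ s, mulTerm A B k i := by
  rw [coeff_mul]
  refine finsum_eq_sum_of_support_subset _ ((mulTerm_support hA hB k).trans ?_)
  rw [← Finset.coe_Icc]
  exact_mod_cast hs

theorem coeff_mul_eq_sum' {A B : DiffOp d} {N M : ℤ} (hA : ∀ k, N < k → A.coeff k = 0)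
    (hB : ∀ k, M < k → B.coeff k = 0) (k c : ℤ) {s : Finset ℤ}
    (hs : Finset.Icc (k - M + c) (N + c) ⊆ s) :
    (A * B).coeff k = ∑ i ∈ s, mulTerm A B k (i - c) := by
  rw [coeff_mul, ← finsum_comp_equiv (Equiv.subRight c)]
  refine finsum_eq_sum_of_support_subset _ fun i hi => hs ?_
  have := mulTerm_support hA hB k (show i - c ∈ _ from hi)
  rw [Set.mem_Icc] at this
  rw [Finset.mem_Icc]
  omega

theorem mul_assoc' (A B C : DiffOp d) : A * B * C = A * (B * C) := by
  obtain ⟨N, hN⟩ := A.bdd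
  obtain ⟨M, hM⟩ := B.bdd
  obtain ⟨Q, hQ⟩ := C.bdd
  have hAB : ∀ k, N + M < k → (A * B).coeff k = 0 := fun k hk => by
    rw [coeff_mul_eq_sum hN hM k (s := ∅) (by rw [Finset.Icc_eq_empty (by omega)])]
    simp
  have hBC : ∀ k, M + Q < k → (B * C).coeff k = 0 := fun k hk => by
    rw [coeff_mul_eq_sum hM hQ k (s := ∅) (by rw [Finset.Icc_eq_empty (by omega)])]
    simp
  ext1
  funext k
  have hl : (A * B * C).coeff k = ∑ m ∈ Finset.Icc (k - Q) (N + M),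
      ∑ i ∈ Finset.Icc (k - (M + Q)) N, halfShift d (-(k - i)) (A.coeff i) *
        halfShift d (i - (k - m)) (B.coeff (m - i)) * halfShift d m (C.coeff (k - m)) := by
    rw [coeff_mul_eq_sum hAB hQ k (Finset.Subset.refl _)]
    refine Finset.sum_congr rfl fun m hm => ?_
    rw [Finset.mem_Icc] at hm
    rw [mulTerm, coeff_mul_eq_sum hN hM m (s := Finset.Icc (k - (M + Q)) N)
      (Finset.Icc_subset_Icc (by omega) le_rfl), map_sum, Finset.sum_mul]
    refine Finset.sum_congr rfl fun i _ => ?_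
    rw [mulTerm, map_mul, halfShift_halfShift, halfShift_halfShift]
    rw [show -(k - m) + -(m - i) = -(k - i) by ring, show -(k - m) + i = i - (k - m) by ring]
  have hr : (A * (B * C)).coeff k = ∑ i ∈ Finset.Icc (k - (M + Q)) N,
      ∑ m ∈ Finset.Icc (k - Q) (N + M), halfShift d (-(k - i)) (A.coeff i) *
        halfShift d (i - (k - m)) (B.coeff (m - i)) * halfShift d m (C.coeff (k - m)) := by
    rw [coeff_mul_eq_sum hN hBC k (Finset.Subset.refl _)]
    refine Finset.sum_congr rfl fun i hi => ?_
    rw [Finset.mem_Icc] at hi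
    rw [mulTerm, coeff_mul_eq_sum' hM hQ (k - i) i (s := Finset.Icc (k - Q) (N + M))
      (Finset.Icc_subset_Icc (by omega) (by omega)), map_sum, Finset.mul_sum]
    refine Finset.sum_congr rfl fun m _ => ?_
    rw [mulTerm, map_mul, halfShift_halfShift, halfShift_halfShift, mul_assoc]
    rw [show i + -(k - i - (m - i)) = i - (k - m) by ring, show i + (m - i) = m by ring,
      show k - i - (m - i) = k - m by ring]
  rw [hl, hr, Finset.sum_comm]

theorem coeff_single_mul (i : ℤ) (a : R⟦X⟧) (B : DiffOp d) (k : ℤ) :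
    (single i a * B).coeff k = halfShift d (-(k - i)) a * halfShift d i (B.coeff (k - i)) := by
  rw [coeff_mul, finsum_eq_single _ i]
  · simp [mulTerm, coeff_single]
  · intro j hj
    simp [mulTerm, coeff_single, hj]

theorem coeff_mul_single (j : ℤ) (b : R⟦X⟧) (A : DiffOp d) (k : ℤ) :
    (A * single j b).coeff k = halfShift d (-j) (A.coeff (k - j)) * halfShift d (k - j) b := by
  rw [coeff_mul, finsum_eq_single _ (k - j)]
  · simp [mulTerm, coeff_single]
  · intro i hi
    have : k - i ≠ j := by omega
    simp [mulTerm, coeff_single, this]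

theorem mul_add' (A B C : DiffOp d) : A * (B + C) = A * B + A * C := by
  obtain ⟨N, hN⟩ := A.bdd
  obtain ⟨M, hM⟩ := B.bdd
  obtain ⟨Q, hQ⟩ := C.bdd
  have hB : ∀ k, max M Q < k → B.coeff k = 0 := fun k hk => hM k (by omega)
  have hC : ∀ k, max M Q < k → C.coeff k = 0 := fun k hk => hQ k (by omega)
  have hBC : ∀ k, max M Q < k → (B + C).coeff k = 0 := fun k hk => by
    simp [hB k hk, hC k hk]
  ext1
  funext k
  rw [coeff_add, coeff_mul_eq_sum hN hB k (Finset.Subset.refl _),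
    coeff_mul_eq_sum hN hC k (Finset.Subset.refl _),
    coeff_mul_eq_sum hN hBC k (Finset.Subset.refl _), ← Finset.sum_add_distrib]
  simp [mulTerm, mul_add]

theorem add_mul' (A B C : DiffOp d) : (A + B) * C = A * C + B * C := by
  obtain ⟨N, hN⟩ := A.bdd
  obtain ⟨M, hM⟩ := B.bdd
  obtain ⟨Q, hQ⟩ := C.bdd
  have hA : ∀ k, max N M < k → A.coeff k = 0 := fun k hk => hN k (by omega)
  have hB : ∀ k, max N M < k → B.coeff k = 0 := fun k hk => hM k (by omega)
  have hAB : ∀ k, max N M < k → (A + B).coeff k = 0 := fun k hk => by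
    simp [hA k hk, hB k hk]
  ext1
  funext k
  rw [coeff_add, coeff_mul_eq_sum hA hQ k (Finset.Subset.refl _),
    coeff_mul_eq_sum hB hQ k (Finset.Subset.refl _),
    coeff_mul_eq_sum hAB hQ k (Finset.Subset.refl _), ← Finset.sum_add_distrib]
  simp [mulTerm, add_mul]

instance : Ring (DiffOp d) where
  add_assoc A B C := by ext1; funext k; simp [add_assoc]
  zero_add A := by ext1; funext k; simp
  add_zero A := by ext1; funext k; simp
  add_comm A B := by ext1; funext k; simp [add_comm]
  neg_add_cancel A := by ext1; funext k; simp
  nsmul := nsmulRec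
  zsmul := zsmulRec
  left_distrib := mul_add'
  right_distrib := add_mul'
  zero_mul A := by ext1; funext k; simp [coeff_mul, mulTerm]
  mul_zero A := by ext1; funext k; simp [coeff_mul, mulTerm]
  mul_assoc := mul_assoc'
  one_mul A := by
    ext1
    funext k
    exact (coeff_single_mul 0 1 A k).trans (by simp [halfShift_zero])
  mul_one A := by
    ext1
    funext k
    exact (coeff_mul_single 0 1 A k).trans (by simp [halfShift_zero])

@[simp] theorem coeff_sub (A B : DiffOp d) (k : ℤ) :
    (A - B).coeff k = A.coeff k - B.coeff k := by
  rw [sub_eq_add_neg, coeff_add, coeff_neg, sub_eq_add_neg]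

theorem coeff_mul_eq_zero {A B : DiffOp d} {N M : ℤ} (hA : ∀ k, N < k → A.coeff k = 0)
    (hB : ∀ k, M < k → B.coeff k = 0) (k : ℤ) (hk : N + M < k) : (A * B).coeff k = 0 := by
  rw [coeff_mul_eq_sum hA hB k (s := ∅) (by rw [Finset.Icc_eq_empty (by omega)])]
  simp

theorem coeff_mul_top {A B : DiffOp d} {N M : ℤ} (hA : ∀ k, N < k → A.coeff k = 0)
    (hB : ∀ k, M < k → B.coeff k = 0) :
    (A * B).coeff (N + M) = halfShift d (-M) (A.coeff N) * halfShift d N (B.coeff M) := by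
  rw [coeff_mul_eq_sum hA hB (N + M) (s := {N}) (by
    rw [add_sub_cancel_right, Finset.Icc_self])]
  simp [mulTerm]

end DiffOp

open DiffOp

variable {d}

theorem pow_monic {V : DiffOp d} (h1 : V.coeff 1 = 1) (h : ∀ k, 1 < k → V.coeff k = 0) (n : ℕ) :
    (V ^ n).coeff n = 1 ∧ ∀ k : ℤ, n < k → (V ^ n).coeff k = 0 := by
  induction n with
  | zero =>
    rw [pow_zero]
    refine ⟨by simp [coeff_one], fun k hk => ?_⟩
    rw [coeff_one, if_neg (by push_cast at hk; omega)]
  | succ n ih =>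
    rw [pow_succ]
    push_cast
    refine ⟨?_, fun k hk => coeff_mul_eq_zero ih.2 h k hk⟩
    rw [coeff_mul_top ih.2 h, ih.1, h1, map_one, map_one, mul_one]

/-- The series of the operator `[n] = (E^{n/2} - E^{-n/2}) / (E^{1/2} - E^{-1/2})`. -/
def bracketSeries (n : ℕ) : ℚ⟦X⟧ := ∑ i ∈ Finset.range n, expSeries ((2 * i - n + 1) / 2)

theorem bracketSeries_succ (n : ℕ) :
    bracketSeries (n + 1) = expSeries (1 / 2) * bracketSeries n + expSeries (-n / 2) := by
  rw [bracketSeries, Finset.sum_range_succ', bracketSeries, Finset.mul_sum]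
  congr 1
  · refine Finset.sum_congr rfl fun i _ => ?_
    rw [expSeries_add]
    congr 1
    push_cast
    ring
  · congr 1
    push_cast
    ring

theorem bracketSeries_mul_inv {n : ℕ} (hn : 0 < n) :
    bracketSeries n * (bracketSeries n)⁻¹ = 1 := by
  apply PowerSeries.mul_inv_cancel
  rw [bracketSeries, map_sum]
  have : ∀ s, PowerSeries.constantCoeff (expSeries s) = 1 := fun s => by
    rw [← PowerSeries.coeff_zero_eq_constantCoeff_apply, coeff_expSeries]
    simp
  simp [this, hn.ne']

theorem op_bracket_injective {n : ℕ} (hn : 0 < n) {f : R⟦X⟧}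
    (h : op d (bracketSeries n) f = 0) : f = 0 := by
  rw [← op_one d f, ← bracketSeries_mul_inv hn, mul_comm, op_mul, h, map_zero]

theorem leading_term {U V Y : DiffOp d} {T : ℕ → DiffOp d} {m : ℤ}
    (hU1 : U.coeff 1 = 1) (hU : ∀ k, 1 < k → U.coeff k = 0)
    (hV1 : V.coeff 1 = 1) (hV : ∀ k, 1 < k → V.coeff k = 0)
    (hY : ∀ k, m < k → Y.coeff k = 0)
    (hT0 : T 0 = 0) (hT : ∀ n, T (n + 1) = U * T n + Y * V ^ n) (n : ℕ) :
    (T n).coeff (n - 1 + m) = op d (bracketSeries n) (Y.coeff m) ∧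
      ∀ k : ℤ, n - 1 + m < k → (T n).coeff k = 0 := by
  induction n with
  | zero =>
    rw [hT0]
    refine ⟨?_, fun k _ => rfl⟩
    ext n
    simp [bracketSeries, coeff_op]
  | succ n ih =>
    have hVn := pow_monic hV1 hV n
    rw [hT]
    refine ⟨?_, fun k hk => ?_⟩
    · have e1 := coeff_mul_top hU ih.2
      have e2 := coeff_mul_top hY hVn.2
      rw [hU1, map_one, one_mul, ih.1] at e1
      rw [hVn.1, map_one, mul_one] at e2
      rw [coeff_add]
      push_cast
      rw [show (n : ℤ) + 1 - 1 + m = 1 + (n - 1 + m) by ring, e1,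
        show (1 : ℤ) + (n - 1 + m) = m + n by ring, e2, bracketSeries_succ, op_add, op_mul,
        halfShift_eq_op, halfShift_eq_op]
      push_cast
      rfl
    · push_cast at hk
      rw [coeff_add, coeff_mul_eq_zero hU ih.2 k (by omega),
        coeff_mul_eq_zero hY hVn.2 k (by omega), add_zero]

theorem pow_sub_pow_leading {A B : DiffOp d} {m : ℤ}
    (hA1 : A.coeff 1 = 1) (hA : ∀ k, 1 < k → A.coeff k = 0)
    (hB1 : B.coeff 1 = 1) (hB : ∀ k, 1 < k → B.coeff k = 0)
    (hAB : ∀ k, m < k → A.coeff k = B.coeff k) (n : ℕ) :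
    (A ^ n).coeff (n - 1 + m) - (B ^ n).coeff (n - 1 + m) =
        op d (bracketSeries n) (A.coeff m - B.coeff m) ∧
      ∀ k : ℤ, n - 1 + m < k → (A ^ n).coeff k = (B ^ n).coeff k := by
  have := leading_term (Y := A - B) (T := fun n => A ^ n - B ^ n) (m := m) hA1 hA hB1 hB
    (fun k hk => by rw [coeff_sub, hAB k hk, sub_self]) (by simp)
    (fun n => by rw [pow_succ', pow_succ']; noncomm_ring) n
  simp only [coeff_sub] at this
  exact ⟨this.1, fun k hk => sub_eq_zero.1 (this.2 k hk)⟩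

theorem der_add (f g : R⟦X⟧) : der d (f + g) = der d f + der d g := by
  ext n
  simp [der]

theorem der_zero : der d (0 : R⟦X⟧) = 0 := by
  ext n
  simp [der]

theorem der_sum {ι : Type*} (s : Finset ι) (g : ι → R⟦X⟧) :
    der d (∑ i ∈ s, g i) = ∑ i ∈ s, der d (g i) := by
  ext n
  simp [der]

theorem der_mul (f g : R⟦X⟧) : der d (f * g) = der d f * g + f * der d g := by
  ext n
  simp only [der, PowerSeries.coeff_mk, PowerSeries.coeff_mul, map_add, map_sum,
    Derivation.leibniz, smul_eq_mul, Finset.sum_add_distrib]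
  rw [add_comm]
  congr 1
  exact Finset.sum_congr rfl fun _ _ => mul_comm _ _

theorem der_op (φ : ℚ⟦X⟧) (f : R⟦X⟧) : der d (op d φ f) = op d φ (der d f) := by
  ext n
  simp only [der, PowerSeries.coeff_mk, coeff_op, map_sum]
  refine Finset.sum_congr rfl fun p _ => ?_
  rw [map_rat_smul, ← Function.iterate_succ_apply' d, Function.iterate_succ_apply]

theorem halfShift_const {f : R⟦X⟧} (hf : der d f = 0) (k : ℤ) : halfShift d k f = f := by
  have h : ∀ n, d (PowerSeries.coeff n f) = 0 := fun n => by
    have := congrArg (PowerSeries.coeff n) hf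
    simpa [der] using this
  ext n
  rw [halfShift_eq_op, coeff_op, Finset.sum_eq_single (0, n)]
  · simp [coeff_expSeries]
  · rintro ⟨a, b⟩ hab hne
    cases a with
    | zero =>
      simp at hab
      exact absurd (by simp [hab]) hne
    | succ a => simp [h, iterate_map_zero]
  · simp

/-- The action of `∂` on the coefficients of a difference operator. -/
def derOp (A : DiffOp d) : DiffOp d := ⟨fun k => der d (A.coeff k), by
  obtain ⟨N, hN⟩ := A.bdd
  exact ⟨N, fun k hk => by rw [hN k hk, der_zero]⟩⟩

theorem derOp_mul (A B : DiffOp d) : derOp (A * B) = derOp A * B + A * derOp B := by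
  obtain ⟨N, hN⟩ := A.bdd
  obtain ⟨M, hM⟩ := B.bdd
  have hN' : ∀ k, N < k → (derOp A).coeff k = 0 := fun k hk => by
    simp [derOp, hN k hk, der_zero]
  have hM' : ∀ k, M < k → (derOp B).coeff k = 0 := fun k hk => by
    simp [derOp, hM k hk, der_zero]
  ext1
  funext k
  rw [coeff_add, coeff_mul_eq_sum hN' hM k (Finset.Subset.refl _),
    coeff_mul_eq_sum hN hM' k (Finset.Subset.refl _), ← Finset.sum_add_distrib]
  change der d ((A * B).coeff k) = _
  rw [coeff_mul_eq_sum hN hM k (Finset.Subset.refl _), der_sum]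
  refine Finset.sum_congr rfl fun i _ => ?_
  simp only [mulTerm, derOp, der_mul, halfShift_eq_op, der_op]

/-! ### The Lax operator of the equivariant Toda lattice -/

/-- The operator `K = Λ + v + q Λ⁻¹`. -/
def opK (v q : R⟦X⟧) : DiffOp d := single 1 1 + single 0 v + single (-1) q

/-- `L = Λ + v + a₂ Λ⁻¹ + a₃ Λ⁻² + ⋯` satisfies the constraint `ε⁻¹[K, L] = τ ∂L` of the
equivariant Toda lattice, and `zₙ`, for `n > 0`, are its constants of motion
`p₋₁(n) - q p₁(n) - τ P p₀(n)`, where `Lⁿ = ∑ pₖ(n) Λᵏ`. -/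
structure IsLax (v q τ : R⟦X⟧) (z : ℕ → R⟦X⟧) (L : DiffOp d) : Prop where
  coeff_gt : ∀ k, 1 < k → L.coeff k = 0
  coeff_one : L.coeff 1 = 1
  coeff_zero : L.coeff 0 = v
  constraint : ∀ k, (opK v q * L - L * opK v q).coeff k =
    PowerSeries.X * (τ * der d (L.coeff k))
  constants : ∀ n : ℕ, 0 < n →
    (L ^ n).coeff (-1) - q * (L ^ n).coeff 1 - τ * opP d ((L ^ n).coeff 0) = z n

section Existence

variable (d) (v q τ : R⟦X⟧) (z : ℕ → R⟦X⟧)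

/-- Successive approximations to the Lax operator. -/
def laxApprox : ℕ → DiffOp d
  | 0 => single 1 1 + single 0 v
  | n + 1 => laxApprox n + single (-(n + 1 : ℕ)) (op d (bracketSeries (n + 1))⁻¹
      (z (n + 1) - ((laxApprox n ^ (n + 1)).coeff (-1) - q * (laxApprox n ^ (n + 1)).coeff 1
        - τ * opP d ((laxApprox n ^ (n + 1)).coeff 0))))

theorem laxApprox_high (n : ℕ) : (laxApprox d v q τ z n).coeff 1 = 1 ∧
    (laxApprox d v q τ z n).coeff 0 = v ∧
    ∀ k, 1 < k → (laxApprox d v q τ z n).coeff k = 0 := by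
  induction n with
  | zero =>
    refine ⟨by simp [laxApprox, coeff_single], by simp [laxApprox, coeff_single], fun k hk => ?_⟩
    have h1 : k ≠ 1 := by omega
    have h0 : k ≠ 0 := by omega
    simp [laxApprox, coeff_single, h1, h0]
  | succ n ih =>
    obtain ⟨h1, h0, hk⟩ := ih
    refine ⟨?_, ?_, fun k hk' => ?_⟩
    · rw [laxApprox, coeff_add, coeff_single, if_neg (by push_cast; omega), h1, add_zero]
    · rw [laxApprox, coeff_add, coeff_single, if_neg (by push_cast; omega), h0, add_zero]
    · rw [laxApprox, coeff_add, coeff_single, if_neg (by push_cast; omega), hk k hk', add_zero]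

theorem laxApprox_succ_coeff (n : ℕ) (k : ℤ) (hk : -(n + 1 : ℤ) ≠ k) :
    (laxApprox d v q τ z (n + 1)).coeff k = (laxApprox d v q τ z n).coeff k := by
  rw [laxApprox, coeff_add, coeff_single, if_neg (by push_cast; omega), add_zero]

theorem laxApprox_stable (m n : ℕ) (hmn : m ≤ n) (k : ℤ) (hk : -(m : ℤ) ≤ k) :
    (laxApprox d v q τ z n).coeff k = (laxApprox d v q τ z m).coeff k := by
  induction n, hmn using Nat.le_induction with
  | base => rfl
  | succ n hmn ih => rw [laxApprox_succ_coeff _ _ _ _ _ _ _ (by omega), ih]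

theorem laxApprox_constants (n : ℕ) :
    (laxApprox d v q τ z (n + 1) ^ (n + 1)).coeff (-1)
      - q * (laxApprox d v q τ z (n + 1) ^ (n + 1)).coeff 1
      - τ * opP d ((laxApprox d v q τ z (n + 1) ^ (n + 1)).coeff 0) = z (n + 1) := by
  obtain ⟨h1, h0, hk⟩ := laxApprox_high d v q τ z n
  obtain ⟨h1', h0', hk'⟩ := laxApprox_high d v q τ z (n + 1)
  obtain ⟨e, e'⟩ := pow_sub_pow_leading (m := -(n + 1)) h1' hk' h1 hk
    (fun k hk => laxApprox_succ_coeff _ _ _ _ _ _ _ (by omega)) (n + 1)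
  have hc : (laxApprox d v q τ z (n + 1)).coeff (-(n + 1)) -
      (laxApprox d v q τ z n).coeff (-(n + 1)) = op d (bracketSeries (n + 1))⁻¹
      (z (n + 1) - ((laxApprox d v q τ z n ^ (n + 1)).coeff (-1)
        - q * (laxApprox d v q τ z n ^ (n + 1)).coeff 1
        - τ * opP d ((laxApprox d v q τ z n ^ (n + 1)).coeff 0))) := by
    rw [laxApprox, coeff_add, coeff_single, if_pos (by push_cast; rfl), add_sub_cancel_left]
  rw [hc, ← op_mul, bracketSeries_mul_inv (Nat.succ_pos n), op_one] at e
  have hz : ((n + 1 : ℕ) : ℤ) - 1 + -(n + 1) = -1 := by push_cast; ring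
  rw [hz] at e e'
  rw [e' 0 (by omega), e' 1 (by omega), sub_eq_iff_eq_add.1 e]
  ring

/-- The limit of the successive approximations. -/
def laxLimit : DiffOp d :=
  ⟨fun k => (laxApprox d v q τ z (-k).toNat).coeff k, 1,
    fun k hk => (laxApprox_high d v q τ z _).2.2 k hk⟩

theorem laxLimit_coeff (n : ℕ) (k : ℤ) (hk : -(n : ℤ) ≤ k) :
    (laxLimit d v q τ z).coeff k = (laxApprox d v q τ z n).coeff k :=
  (laxApprox_stable d v q τ z (-k).toNat n (by omega) k (by omega)).symm

theorem laxLimit_constants (n : ℕ) (hn : 0 < n) :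
    (laxLimit d v q τ z ^ n).coeff (-1) - q * (laxLimit d v q τ z ^ n).coeff 1
      - τ * opP d ((laxLimit d v q τ z ^ n).coeff 0) = z n := by
  obtain ⟨m, rfl⟩ : ∃ m, n = m + 1 := ⟨n - 1, by omega⟩
  obtain ⟨h1, h0, hk⟩ := laxApprox_high d v q τ z (m + 1)
  have e := (pow_sub_pow_leading (A := laxLimit d v q τ z) (m := -(m + 2))
    (by rw [laxLimit_coeff d v q τ z (m + 1) 1 (by omega), h1])
    (fun k hk' => by rw [laxLimit_coeff d v q τ z (m + 1) k (by omega), hk k hk']) h1 hk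
    (fun k hk' => laxLimit_coeff d v q τ z (m + 1) k (by push_cast; omega)) (m + 1)).2
  rw [e (-1) (by push_cast; omega), e 0 (by push_cast; omega), e 1 (by push_cast; omega)]
  exact laxApprox_constants d v q τ z m

variable {d v q τ z}

theorem constraint_of_constants (hτ : der d τ = 0) (hz : ∀ n, der d (z n) = 0) {L : DiffOp d}
    (h : ∀ k, 1 < k → L.coeff k = 0) (h1 : L.coeff 1 = 1) (h0 : L.coeff 0 = v)
    (hc : ∀ n : ℕ, 0 < n →
      (L ^ n).coeff (-1) - q * (L ^ n).coeff 1 - τ * opP d ((L ^ n).coeff 0) = z n) (k : ℤ) :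
    (opK v q * L - L * opK v q).coeff k = PowerSeries.X * (τ * der d (L.coeff k)) := by
  set t : DiffOp d := single 0 (PowerSeries.X * τ) with ht
  have hXτ : der d (PowerSeries.X * τ) = 0 := by
    rw [der_mul, hτ, mul_zero, add_zero]
    ext n
    have hX : der d (PowerSeries.X : R⟦X⟧) = 0 := by
      ext n
      simp only [der, PowerSeries.coeff_mk, PowerSeries.coeff_X, map_zero]
      split_ifs <;> simp
    rw [hX, zero_mul]
  have ht_left : ∀ (A : DiffOp d) k, (t * A).coeff k = PowerSeries.X * τ * A.coeff k := by
    intro A k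
    rw [ht, coeff_single_mul, halfShift_const hXτ, halfShift_zero, sub_zero]
  have ht_comm : ∀ A : DiffOp d, t * A = A * t := by
    intro A
    ext1
    funext k
    rw [ht_left, ht, coeff_mul_single, halfShift_const hXτ, neg_zero, halfShift_zero, sub_zero,
      mul_comm]
  set D : DiffOp d → DiffOp d := fun A => opK v q * A - A * opK v q - t * derOp A with hD
  have hDmul : ∀ A B, D (A * B) = A * D B + D A * B := by
    intro A B
    simp only [hD]
    rw [derOp_mul, mul_add, ← mul_assoc t A, ht_comm A]
    noncomm_ring
  have hD1 : D 1 = 0 := by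
    have := hDmul 1 1
    simpa using this
  suffices hX : ∀ m : ℕ, ∀ k : ℤ, -(m : ℤ) < k → (D L).coeff k = 0 by
    have := hX (-k + 1).toNat k (by omega)
    rw [hD, coeff_sub, ht_left, sub_eq_zero] at this
    rw [this, mul_assoc]
    rfl
  have hres : ∀ n : ℕ, 0 < n → (D (L ^ n)).coeff 0 = 0 := by
    intro n hn
    have e := hc n hn
    have hzz := hz n
    have ez : halfShift d 1 (z n) - halfShift d (-1) (z n) = 0 := by
      rw [halfShift_const hzz, halfShift_const hzz, sub_self]
    rw [← e] at ez
    simp only [map_sub, map_mul, halfShift_const hτ] at ez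
    have eP := halfShift_sub_opP d ((L ^ n).coeff 0)
    simp only [hD, coeff_sub, ht_left, opK, add_mul, mul_add, coeff_add, coeff_single_mul,
      coeff_mul_single, derOp]
    simp only [halfShift_zero, sub_zero, zero_sub, neg_neg, neg_zero, map_one]
    linear_combination ez + τ * eP
  have hlead := fun m hm n => leading_term (T := fun n => D (L ^ n)) (Y := D L) (m := m)
    h1 h h1 h hm (by simpa using hD1) (fun n => by rw [pow_succ', hDmul]) n
  intro m
  induction m with
  | zero =>
    intro k hk
    have hKL : ∀ k, -1 < k → (opK v q - L).coeff k = 0 := by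
      intro k hk
      rcases lt_trichotomy k 1 with h' | rfl | h'
      · obtain rfl : k = 0 := by omega
        simp [opK, coeff_single, h0]
      · simp [opK, coeff_single, h1]
      · have a : k ≠ 1 := by omega
        have b : k ≠ 0 := by omega
        have c : k ≠ -1 := by omega
        simp [opK, coeff_single, h k h', a, b, c]
    have e : D L = (opK v q - L) * L - L * (opK v q - L) - t * derOp L := by
      simp only [hD]
      noncomm_ring
    have hd : der d (L.coeff k) = 0 := by
      have hk : 0 < k := by simpa using hk
      rcases (show k = 1 ∨ 1 < k by omega) with rfl | h'
      · rw [h1]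
        ext n
        simp only [der, PowerSeries.coeff_mk, PowerSeries.coeff_one, map_zero]
        split_ifs <;> simp
      · rw [h k h', der_zero]
    rw [e, coeff_sub, coeff_sub, coeff_mul_eq_zero hKL h k (by push_cast at hk; omega),
      coeff_mul_eq_zero h hKL k (by push_cast at hk; omega), ht_left]
    change 0 - 0 - _ * der d (L.coeff k) = 0
    rw [hd]
    ring
  | succ m ih =>
    intro k hk
    push_cast at hk
    rcases (show k = -m ∨ -(m : ℤ) < k by omega) with rfl | h'
    · have e := (hlead (-m) ih (m + 1)).1
      push_cast at e
      rw [show (m : ℤ) + 1 - 1 + -m = 0 by ring, hres (m + 1) (Nat.succ_pos m)] at e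
      exact op_bracket_injective (Nat.succ_pos m) e.symm
    · exact ih k h'

theorem IsLax.unique {L L' : DiffOp d} (hL : IsLax v q τ z L) (hL' : IsLax v q τ z L') :
    L = L' := by
  suffices h : ∀ m : ℕ, ∀ k : ℤ, -(m : ℤ) ≤ k → L.coeff k = L'.coeff k by
    ext1
    funext k
    exact h (-k).toNat k (by omega)
  intro m
  induction m with
  | zero =>
    intro k hk
    rcases lt_trichotomy k 1 with h' | rfl | h'
    · obtain rfl : k = 0 := by
        push_cast at hk
        omega
      rw [hL.coeff_zero, hL'.coeff_zero]
    · rw [hL.coeff_one, hL'.coeff_one]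
    · rw [hL.coeff_gt k h', hL'.coeff_gt k h']
  | succ m ih =>
    intro k hk
    push_cast at hk
    rcases (show k = -(m + 1) ∨ -(m : ℤ) ≤ k by omega) with rfl | h'
    · obtain ⟨e, e'⟩ := pow_sub_pow_leading (m := -(m + 1)) hL.coeff_one hL.coeff_gt
        hL'.coeff_one hL'.coeff_gt (fun k hk => ih k (by omega)) (m + 1)
      have hz : ((m + 1 : ℕ) : ℤ) - 1 + -(m + 1) = -1 := by push_cast; ring
      rw [hz] at e e'
      have a := hL.constants (m + 1) (Nat.succ_pos m)
      rw [← hL'.constants (m + 1) (Nat.succ_pos m), e' 0 (by omega), e' 1 (by omega)] at a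
      have a' : (L ^ (m + 1)).coeff (-1) - (L' ^ (m + 1)).coeff (-1) = 0 := by
        linear_combination a
      rw [a'] at e
      exact sub_eq_zero.1 (op_bracket_injective (Nat.succ_pos m) e.symm)
    · exact ih k h'

theorem existsUnique_isLax (hτ : der d τ = 0) (hz : ∀ n, der d (z n) = 0) :
    ∃! L : DiffOp d, IsLax v q τ z L := by
  have h1 : (laxLimit d v q τ z).coeff 1 = 1 := (laxApprox_high d v q τ z (-(1 : ℤ)).toNat).1
  have h0 : (laxLimit d v q τ z).coeff 0 = v :=
    (laxApprox_high d v q τ z (-(0 : ℤ)).toNat).2.1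
  have h : ∀ k, 1 < k → (laxLimit d v q τ z).coeff k = 0 :=
    fun k hk => (laxApprox_high d v q τ z _).2.2 k hk
  have hc := laxLimit_constants d v q τ z
  exact ⟨_, ⟨h, h1, h0, constraint_of_constants hτ hz h h1 h0 hc, hc⟩,
    fun L hL => hL.unique ⟨h, h1, h0, constraint_of_constants hτ hz h h1 h0 hc, hc⟩⟩

end Existence

end Operators

noncomputable section Toda

/-! ### The differential algebra of the equivariant Toda lattice, in the jets of `v` and `u` -/

/-- The constants `τ`, `z₁, z₂, …` and `z̄₁, z̄₂, …`; here `z k` stands for `z_{k+1}`. -/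
inductive ConstVar
  | tau
  | z (k : ℕ)
  | zbar (k : ℕ)

/-- The ring of constants `ℚ[τ, z₁, z₂, …, z̄₁, z̄₂, …]`. -/
abbrev Constants := MvPolynomial ConstVar ℚ

/-- The jet variables `v⁽ᵏ⁾ = ∂ᵏv`, `u⁽ᵏ⁾ = ∂ᵏu`, and `q = eᵘ`. -/
inductive JetVar
  | q
  | v (k : ℕ)
  | u (k : ℕ)

/-- The polynomial ring over the constants in `q = eᵘ` and the jets of `v` and `u`. -/
abbrev Jets := MvPolynomial JetVar Constants

/-- The algebra `ℚ[τ, z, z̄]{v, u}[eᵘ]⟦ε⟧`, where `ε = PowerSeries.X`. -/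
abbrev TodaAlg := PowerSeries Jets

/-- The derivation with `∂q = q ∂u`, `∂v⁽ᵏ⁾ = v⁽ᵏ⁺¹⁾` and `∂u⁽ᵏ⁾ = u⁽ᵏ⁺¹⁾`, vanishing on the
constants. -/
def jetDer : Derivation Constants Jets Jets :=
  MvPolynomial.mkDerivation Constants fun
    | .q => MvPolynomial.X .q * MvPolynomial.X (.u 1)
    | .v k => MvPolynomial.X (.v (k + 1))
    | .u k => MvPolynomial.X (.u (k + 1))

/-- `jetDer` as a derivation over `ℚ`. -/
def jetDerRat : Derivation ℚ Jets Jets := jetDer.restrictScalars ℚ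

/-- A linear operator on jets acts on the coefficients of the powers of `ε`. -/
def coeffwise (T : Jets →ₗ[Constants] Jets) : TodaAlg →ₗ[Constants] TodaAlg where
  toFun f := PowerSeries.mk fun n => T (PowerSeries.coeff n f)
  map_add' f g := by
    ext1 n
    simp
  map_smul' c f := by
    ext1 n
    simp

/-- The derivation `∂` of `TodaAlg`. -/
def totalDer : TodaAlg →ₗ[Constants] TodaAlg := coeffwise jetDer.toLinearMap

/-- The elements `q = eᵘ`, `v` and `u`. -/
def jq : TodaAlg := PowerSeries.C (MvPolynomial.X .q)
def jv : TodaAlg := PowerSeries.C (MvPolynomial.X (.v 0))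
def ju : TodaAlg := PowerSeries.C (MvPolynomial.X (.u 0))

def tau : Constants := MvPolynomial.X .tau

/-- The constant `z_k`, for `k > 0`. -/
def zc (k : ℕ) : Constants := MvPolynomial.X (.z (k - 1))

/-- The operator `P = ε∂ / (E^{1/2} - E^{-1/2})` on `TodaAlg`. -/
def opPToda : TodaAlg →+ TodaAlg := opP jetDerRat

/-! #### The involution -/

/-- The involution of the constants: `τ ↦ -τ`, `z_k ↔ z̄_k`. -/
def conjConst : Constants →+* Constants :=
  (MvPolynomial.aeval fun
    | .tau => -MvPolynomial.X .tau
    | .z k => MvPolynomial.X (.zbar k)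
    | .zbar k => MvPolynomial.X (.z k) : Constants →ₐ[ℚ] Constants).toRingHom

/-- The involution on jets: it commutes with `∂` and sends `q ↦ q`, `u ↦ u`,
`v ↦ v̄ = v - τ P u`. -/
def conjJets : Jets →+* TodaAlg :=
  MvPolynomial.eval₂Hom ((algebraMap Constants TodaAlg).comp conjConst) fun
    | .q => jq
    | .v k => totalDer^[k] (jv - tau • opPToda ju)
    | .u k => totalDer^[k] ju

/-- The involution `f ↦ f̄` of `TodaAlg`, with `ε̄ = ε`. -/
def conj : TodaAlg →+* TodaAlg := extendHom conjJets

theorem totalDer_mul (f g : TodaAlg) : totalDer (f * g) = totalDer f * g + f * totalDer g :=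
  der_mul (d := jetDerRat) f g

theorem totalDer_const (c : Constants) : totalDer (algebraMap Constants TodaAlg c) = 0 := by
  have h : (algebraMap Constants TodaAlg c) = PowerSeries.C (MvPolynomial.C c) := by
    rw [PowerSeries.algebraMap_apply, MvPolynomial.algebraMap_eq]
  ext1 n
  rw [h]
  simp only [totalDer, coeffwise, LinearMap.coe_mk, AddHom.coe_mk, PowerSeries.coeff_mk,
    PowerSeries.coeff_C]
  split_ifs
  · exact jetDer.map_algebraMap c
  · simp

theorem totalDer_jq : totalDer jq = jq * totalDer ju := by
  have h : totalDer ju = PowerSeries.C (MvPolynomial.X (.u 1)) := by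
    ext1 n
    simp only [totalDer, ju, coeffwise, LinearMap.coe_mk, AddHom.coe_mk, PowerSeries.coeff_mk,
      PowerSeries.coeff_C]
    split_ifs
    · exact MvPolynomial.mkDerivation_X _ _ _
    · simp
  rw [h, jq, ← map_mul]
  ext1 n
  simp only [totalDer, coeffwise, LinearMap.coe_mk, AddHom.coe_mk, PowerSeries.coeff_mk,
    PowerSeries.coeff_C]
  split_ifs
  · exact MvPolynomial.mkDerivation_X _ _ _
  · simp

theorem conjJets_jetDer (x : Jets) : conjJets (jetDer x) = totalDer (conjJets x) := by
  induction x using MvPolynomial.induction_on with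
  | C c =>
    rw [conjJets, MvPolynomial.coe_eval₂Hom, MvPolynomial.eval₂_C]
    have : jetDer (MvPolynomial.C c) = 0 := jetDer.map_algebraMap c
    rw [this]
    simpa using (totalDer_const (conjConst c)).symm
  | add x y hx hy => rw [map_add, map_add, map_add, map_add, hx, hy]
  | mul_X x i hx =>
    have hi : conjJets (jetDer (MvPolynomial.X i)) = totalDer (conjJets (MvPolynomial.X i)) := by
      rw [jetDer, MvPolynomial.mkDerivation_X]
      cases i with
      | q => simpa [conjJets] using totalDer_jq.symm
      | v k => simp [conjJets, Function.iterate_succ_apply', -Function.iterate_succ]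
      | u k => simp [conjJets, Function.iterate_succ_apply', -Function.iterate_succ]
    rw [Derivation.leibniz, map_mul, totalDer_mul, map_add, smul_eq_mul, smul_eq_mul, map_mul,
      map_mul, hx, hi]
    ring

theorem conj_totalDer (f : TodaAlg) : conj (totalDer f) = totalDer (conj f) := by
  ext1 n
  simp only [conj, extendHom, RingHom.coe_mk, MonoidHom.coe_mk, OneHom.coe_mk,
    PowerSeries.coeff_mk]
  have h : ∀ p : ℕ × ℕ, PowerSeries.coeff p.1 (conjJets (PowerSeries.coeff p.2 (totalDer f))) =
      jetDer (PowerSeries.coeff p.1 (conjJets (PowerSeries.coeff p.2 f))) := by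
    intro p
    have h1 : PowerSeries.coeff p.2 (totalDer f) = jetDer (PowerSeries.coeff p.2 f) := by
      simp [totalDer, coeffwise]
    rw [h1, conjJets_jetDer]
    simp [totalDer, coeffwise]
  simp only [h]
  simp [totalDer, coeffwise]

theorem conj_const (c : Constants) :
    conj (algebraMap Constants TodaAlg c) = algebraMap Constants TodaAlg (conjConst c) := by
  have h : (algebraMap Constants TodaAlg c) = PowerSeries.C (MvPolynomial.C c) := by
    rw [PowerSeries.algebraMap_apply, MvPolynomial.algebraMap_eq]
  ext1 n
  simp only [conj, extendHom, RingHom.coe_mk, MonoidHom.coe_mk, OneHom.coe_mk,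
    PowerSeries.coeff_mk]
  rw [Finset.sum_eq_single (n, 0)]
  · rw [h]
    simp [conjJets]
  · rintro ⟨a, b⟩ hab hne
    have hb : b ≠ 0 := by
      rintro rfl
      simp at hab
      exact hne (by simp [hab])
    rw [h]
    simp [PowerSeries.coeff_C, hb]
  · simp

/-- The involution as a map semilinear over the involution of the constants. -/
def conjSemilinear : TodaAlg →ₛₗ[conjConst] TodaAlg where
  toFun := conj
  map_add' := map_add conj
  map_smul' c f := by
    rw [Algebra.smul_def, map_mul, conj_const, Algebra.smul_def]

/-! #### Functionals and variational derivatives -/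

/-- The space of functionals, the quotient of `TodaAlg` by total derivatives. -/
abbrev Functional := TodaAlg ⧸ LinearMap.range totalDer

/-- The functional `∫ f dx` with density `f`. -/
def integral : TodaAlg →ₗ[Constants] Functional := (LinearMap.range totalDer).mkQ

/-- The involution on functionals. -/
def conjFunctional : Functional →ₛₗ[conjConst] Functional :=
  (LinearMap.range totalDer).mapQ (LinearMap.range totalDer) conjSemilinear (by
    rintro _ ⟨f, rfl⟩
    exact ⟨conj f, (conj_totalDer f).symm⟩)

/-- The finitely supported sequence of the partial derivatives `∂f/∂v⁽ᵏ⁾`. -/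
def gradV : Derivation Constants Jets (ℕ →₀ Jets) :=
  MvPolynomial.mkDerivation Constants fun
    | .q => 0
    | .v k => Finsupp.single k 1
    | .u _ => 0

/-- The finitely supported sequence of the partial derivatives `∂f/∂u⁽ᵏ⁾`, where `q = eᵘ`. -/
def gradU : Derivation Constants Jets (ℕ →₀ Jets) :=
  MvPolynomial.mkDerivation Constants fun
    | .q => Finsupp.single 0 (MvPolynomial.X .q)
    | .v _ => 0
    | .u k => Finsupp.single k 1

/-- The map `(gₖ) ↦ ∑ₖ (-∂)ᵏ gₖ`. -/
def byParts : (ℕ →₀ Jets) →ₗ[Constants] Jets :=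
  Finsupp.lsum Constants fun k => (-jetDer.toLinearMap : Module.End Constants Jets) ^ k

/-- The map `(gₖ) ↦ (∂gₖ + gₖ₋₁)`. -/
def prolong : (ℕ →₀ Jets) →ₗ[Constants] (ℕ →₀ Jets) :=
  Finsupp.mapRange.linearMap jetDer.toLinearMap + Finsupp.lmapDomain Jets Constants Nat.succ

theorem byParts_prolong (g : ℕ →₀ Jets) : byParts (prolong g) = 0 := by
  induction g using Finsupp.induction_linear with
  | zero => simp
  | add g h hg hh => rw [map_add, map_add, hg, hh, add_zero]
  | single k x =>
    have h1 : prolong (Finsupp.single k x) =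
        Finsupp.single k (jetDer x) + Finsupp.single (k + 1) x := by
      simp [prolong]
    rw [h1, map_add]
    simp [byParts, pow_succ]

theorem prolong_smul (x : Jets) (g : ℕ →₀ Jets) :
    prolong (x • g) = x • prolong g + jetDer x • g := by
  ext1 k
  cases k with
  | zero =>
    have hm : ∀ g : ℕ →₀ Jets, Finsupp.mapDomain Nat.succ g 0 = 0 := fun g =>
      Finsupp.mapDomain_of_notMem_range _ _ (by simp)
    simp [prolong, hm]
    ring
  | succ k =>
    have hm : ∀ g : ℕ →₀ Jets, Finsupp.mapDomain Nat.succ g (k + 1) = g k := fun g =>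
      Finsupp.mapDomain_apply Nat.succ_injective g k
    simp [prolong, hm]
    ring

theorem grad_jetDer {G : Derivation Constants Jets (ℕ →₀ Jets)}
    (hG : ∀ i, G (jetDer (MvPolynomial.X i)) = prolong (G (MvPolynomial.X i))) (x : Jets) :
    G (jetDer x) = prolong (G x) := by
  induction x using MvPolynomial.induction_on with
  | C c =>
    have h1 : jetDer (MvPolynomial.C c) = 0 := jetDer.map_algebraMap c
    have h2 : G (MvPolynomial.C c) = 0 := G.map_algebraMap c
    rw [h1, h2, map_zero, map_zero]
  | add x y hx hy => simp only [map_add, hx, hy]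
  | mul_X x i hx =>
    simp only [Derivation.leibniz, map_add, prolong_smul, smul_eq_mul, hx, hG]
    abel

theorem gradV_jetDer (x : Jets) : gradV (jetDer x) = prolong (gradV x) := by
  refine grad_jetDer (fun i => ?_) x
  cases i <;> simp [gradV, jetDer, prolong, MvPolynomial.mkDerivation_X]

theorem gradU_jetDer (x : Jets) : gradU (jetDer x) = prolong (gradU x) := by
  refine grad_jetDer (fun i => ?_) x
  cases i <;> simp [gradU, jetDer, prolong, MvPolynomial.mkDerivation_X]
  rw [add_comm, mul_comm]

theorem coeffwise_euler {G : Derivation Constants Jets (ℕ →₀ Jets)}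
    (hG : ∀ x, G (jetDer x) = prolong (G x)) :
    LinearMap.range totalDer ≤ LinearMap.ker (coeffwise (byParts ∘ₗ G.toLinearMap)) := by
  rintro _ ⟨f, rfl⟩
  rw [LinearMap.mem_ker]
  ext1 n
  simp [coeffwise, totalDer, hG, byParts_prolong]

/-- The variational derivative `δ_v ∫ f dx = ∑ₖ (-∂)ᵏ (∂f/∂v⁽ᵏ⁾)`. -/
def varV : Functional →ₗ[Constants] TodaAlg :=
  (LinearMap.range totalDer).liftQ (coeffwise (byParts ∘ₗ gradV.toLinearMap))
    (coeffwise_euler gradV_jetDer)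

/-- The variational derivative `δ_u ∫ f dx = ∑ₖ (-∂)ᵏ (∂f/∂u⁽ᵏ⁾)`, where `q = eᵘ`. -/
def varU : Functional →ₗ[Constants] TodaAlg :=
  (LinearMap.range totalDer).liftQ (coeffwise (byParts ∘ₗ gradU.toLinearMap))
    (coeffwise_euler gradU_jetDer)

/-! #### The Lax operator and the Hamiltonians -/

theorem existsUnique_lax : ∃! L : DiffOp jetDerRat,
    IsLax jv jq (algebraMap Constants TodaAlg tau)
      (fun k => algebraMap Constants TodaAlg (zc k)) L :=
  existsUnique_isLax (totalDer_const tau) fun n => totalDer_const (zc n)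

/-- The Lax operator `L` of the equivariant Toda lattice. -/
def lax : DiffOp jetDerRat := existsUnique_lax.choose

theorem lax_isLax : IsLax jv jq (algebraMap Constants TodaAlg tau)
    (fun k => algebraMap Constants TodaAlg (zc k)) lax :=
  existsUnique_lax.choose_spec.1

/-- The coefficient `p_k(n)` of `Λᵏ` in `Lⁿ`. -/
def p (k : ℤ) (n : ℕ) : TodaAlg := (lax ^ n).coeff k

/-- The trace `Res(∑ fₖ Λᵏ) = ∫ f₀ dx`. -/
def trace (A : DiffOp jetDerRat) : Functional := integral (A.coeff 0)

/-- The functional `h_n = Res(L^{n+1}) / (n+1)`. -/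
def h (n : ℕ) : Functional := (1 / (n + 1 : ℚ)) • trace (lax ^ (n + 1))

/-- The Hamiltonian `H_n = h_n - τ h_{n-1} + ∑_{k=1}^{n-1} z_k h_{n-k-1}`, with `h_{-1} = 0`. -/
def H (n : ℕ) : Functional :=
  h n - tau • (if n = 0 then 0 else h (n - 1)) +
    ∑ k ∈ Finset.Icc 1 (n - 1), zc k • h (n - k - 1)

/-- The conjugate Hamiltonian `H̄_n`. -/
def Hbar (n : ℕ) : Functional := conjFunctional (H n)

/-- The conjugate coefficient `p̄_k(n)`. -/
def pbar (k : ℤ) (n : ℕ) : TodaAlg := conj (p k n)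

end Toda

end EqToda

/-! The two formulas for $H_n$ come from an integrated form of the Lax equation. Let `Res` be the
coefficient of $\Lambda^0$ modulo total derivatives; it is a trace, because $\mathsf E^{k/2}f-f$ is
always a total derivative (`res_mul_comm`). Since $\Lambda^m a\Lambda^{-m}=\mathsf E^m a$, the
operator $\log\Lambda$ ought to be $\varepsilon\partial$. It is not a difference operator, but
$\ell=\log L-\varepsilon\partial$ is: the coefficients of $L^m\Lambda^{-m}$ are, at each order in
$\varepsilon$, polynomial in $m$, and $\ell$ collects the coefficients of $m$ (`exists_opHasLinear`,
`exists_log`). It satisfies $[L,\ell]=\varepsilon\,\partial L$.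

With $Y=L^{-1}$, the constraint $[K,L]=\varepsilon\tau\,\partial L$ now says that $L-K-\tau\ell$
commutes with $L$. An operator commuting with $L$ has constant leading coefficient, so
$L-K-\tau\ell$ is a series in $Y$ with constant coefficients. Pairing with powers of $L$ under the
grading derivation $\Lambda^k\mapsto k\Lambda^k$ identifies them through the constants of motion
(`laxTail_order`): $$L=K+\tau\ell+\sum_{k\ge1}\tfrac1k z_kL^{-k}.$$

Let $\delta$ be a derivation commuting with $\partial$ and killing $\tau$ and the $z_k$. Apply it to
this identity, multiply by $L^n$ and take `Res`. The trace property gives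
$\mathrm{Res}(\delta\ell\,L^n)=\mathrm{Res}(\delta L\,L^{n-1})$, while $\mathrm{Res}(\delta
L\,L^n)=\delta h_n$. The terms assemble into $\delta H_n=\mathrm{Res}(\delta K\,L^n)=\int(\delta
v\,p_0(n)+\delta q\,p_1(n))\,dx$ (`der_hamDensity`). Taking for $\delta$ the evolutionary derivation
with arbitrary characteristic $(g,h)$, the first variation formula and the nondegeneracy of
$(f,g)\mapsto\int fg\,dx$ (`eq_zero_of_mul_mem_range`) turn this into the values of $\delta_vH_n$
and $\delta_uH_n$.

For the conjugates, $\bar v=v-\tau\mathsf Pu$ varies by $g-\tau\mathsf Ph$. The chain rule and the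
self-adjointness of $\mathsf P$ give $\delta_v\bar F=\overline{\delta_vF}$ and $\delta_u\bar
F=\overline{\delta_uF}-\tau\mathsf P\,\overline{\delta_vF}$ (`varV_varU_conj`), applied to $F=H_n$.
-/

namespace EqToda

/-! ### The trace, derivations and inverses of difference operators -/

noncomputable section TraceCalculus

open DiffOp

variable {R : Type*} [CommRing R] [Algebra ℚ R] {d : Derivation ℚ R R}

/-! ### Exact series and the trace -/

theorem der_smul (δ : Derivation ℚ R R) (c : ℚ) (f : R⟦X⟧) : der δ (c • f) = c • der δ f := by
  ext n
  simp [der]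

theorem der_X (δ : Derivation ℚ R R) : der δ (PowerSeries.X : R⟦X⟧) = 0 := by
  ext n
  simp only [der, PowerSeries.coeff_mk, PowerSeries.coeff_X, map_zero]
  split_ifs <;> simp

theorem der_one (δ : Derivation ℚ R R) : der δ (1 : R⟦X⟧) = 0 := by
  ext n
  simp only [der, PowerSeries.coeff_mk, PowerSeries.coeff_one, map_zero]
  split_ifs <;> simp

/-- A derivation of `R`, extended to `R⟦ε⟧`, as a linear map. -/
def derLin (δ : Derivation ℚ R R) : R⟦X⟧ →ₗ[ℚ] R⟦X⟧ where
  toFun := der δ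
  map_add' := der_add
  map_smul' := der_smul δ

variable (d) in
/-- The space of total derivatives. -/
def exact : Submodule ℚ R⟦X⟧ := LinearMap.range (derLin d)

/-- Writing $\varphi(t)=\varphi_0+t\psi(t)$, the nonconstant part is $\partial$ applied to
$\varepsilon\psi(\varepsilon\partial)f$. Hence half shifts and $\mathsf P$ act as the identity
modulo total derivatives. -/
theorem op_sub_smul_mem_exact (φ : ℚ⟦X⟧) (f : R⟦X⟧) :
    op d φ f - PowerSeries.constantCoeff φ • f ∈ exact d := by
  refine ⟨PowerSeries.X * op d (PowerSeries.mk fun n => PowerSeries.coeff (n + 1) φ) f, ?_⟩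
  have h := PowerSeries.eq_X_mul_shift_add_const φ
  have hC : op d (PowerSeries.C (PowerSeries.constantCoeff φ)) f =
      PowerSeries.constantCoeff φ • f := by
    have h1 : ∀ c : ℚ, op d (PowerSeries.C c) f = c • op d 1 f := by
      intro c
      ext n
      simp only [coeff_op, PowerSeries.coeff_smul, Finset.smul_sum, smul_smul,
        PowerSeries.coeff_C, PowerSeries.coeff_one]
      refine Finset.sum_congr rfl fun p _ => ?_
      split_ifs <;> simp
    rw [h1, op_one]
  conv_rhs => rw [h]
  rw [op_add, hC, op_mul, op_X]
  simp only [map_add, map_mul, PowerSeries.constantCoeff_X, zero_mul, zero_add,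
    PowerSeries.constantCoeff_C]
  change der d _ = _
  rw [der_mul, der_X, zero_mul, zero_add, add_sub_cancel_right]

theorem constantCoeff_expSeries (s : ℚ) : PowerSeries.constantCoeff (expSeries s) = 1 := by
  rw [← PowerSeries.coeff_zero_eq_constantCoeff_apply, coeff_expSeries]
  simp

theorem constantCoeff_sinhcSeries : PowerSeries.constantCoeff sinhcSeries = 1 := by
  simp [sinhcSeries, ← PowerSeries.coeff_zero_eq_constantCoeff_apply]

theorem halfShift_sub_mem_exact (k : ℤ) (f : R⟦X⟧) : halfShift d k f - f ∈ exact d := by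
  have := op_sub_smul_mem_exact (d := d) (expSeries (k / 2)) f
  rwa [constantCoeff_expSeries, one_smul, ← halfShift_eq_op] at this

theorem opP_sub_mem_exact (f : R⟦X⟧) : opP d f - f ∈ exact d := by
  have := op_sub_smul_mem_exact (d := d) sinhcSeries⁻¹ f
  rwa [PowerSeries.constantCoeff_inv, constantCoeff_sinhcSeries, inv_one, one_smul] at this

theorem const_mul_mem_exact {c f : R⟦X⟧} (hc : der d c = 0) (hf : f ∈ exact d) :
    c * f ∈ exact d := by
  obtain ⟨g, rfl⟩ := hf
  refine ⟨c * g, ?_⟩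
  change der d (c * g) = c * der d g
  rw [der_mul, hc, zero_mul, zero_add]

/-- The coefficients of a difference operator, additively. -/
def coeffHom (k : ℤ) : DiffOp d →+ R⟦X⟧ where
  toFun A := A.coeff k
  map_zero' := rfl
  map_add' _ _ := rfl

/-- The class of the coefficient of `Λ⁰` modulo total derivatives. -/
def res : DiffOp d →+ R⟦X⟧ ⧸ exact d :=
  (exact d).mkQ.toAddMonoidHom.comp (coeffHom 0)

theorem res_apply (A : DiffOp d) : res A = (exact d).mkQ (A.coeff 0) := rfl

theorem res_eq_iff {A B : DiffOp d} : res A = res B ↔ A.coeff 0 - B.coeff 0 ∈ exact d :=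
  Submodule.Quotient.eq _

theorem mkQ_halfShift (k : ℤ) (f : R⟦X⟧) :
    (exact d).mkQ (halfShift d k f) = (exact d).mkQ f :=
  (Submodule.Quotient.eq _).2 (halfShift_sub_mem_exact k f)

theorem mulTerm_zero (A B : DiffOp d) (i : ℤ) :
    mulTerm A B 0 i = halfShift d i (A.coeff i * B.coeff (-i)) := by
  simp [mulTerm]

/-- The $i$-th term for $AB$ and the $(-i)$-th term for $BA$ are shifts of the same product
$a_ib_{-i}$, and shifts are invisible modulo total derivatives. -/
theorem res_mul_comm (A B : DiffOp d) : res (A * B) = res (B * A) := by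
  obtain ⟨N, hN⟩ := A.bdd
  obtain ⟨M, hM⟩ := B.bdd
  rw [res_apply, res_apply, coeff_mul_eq_sum hN hM 0 (Finset.Subset.refl _),
    coeff_mul_eq_sum (s := (Finset.Icc (0 - M) N).map (Equiv.neg ℤ).toEmbedding) hM hN 0 ?_,
    Finset.sum_map, map_sum, map_sum]
  · refine Finset.sum_congr rfl fun i _ => ?_
    simp only [mulTerm_zero, mkQ_halfShift, Equiv.coe_toEmbedding, Equiv.neg_apply, neg_neg]
    rw [mul_comm]
  · intro i hi
    rw [Finset.mem_Icc] at hi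
    simp only [Finset.mem_map, Finset.mem_Icc]
    exact ⟨-i, by omega, by simp⟩

theorem res_eq_zero_of_order {A B : DiffOp d} {N M : ℤ} (hA : ∀ k, N < k → A.coeff k = 0)
    (hB : ∀ k, M < k → B.coeff k = 0) (h : N + M < 0) : res (A * B) = 0 := by
  rw [res_apply, coeff_mul_eq_zero hA hB 0 h, map_zero]

/-! ### Constants -/

/-- Multiplication by a series, as a difference operator. -/
def cst (c : R⟦X⟧) : DiffOp d := single 0 c

theorem coeff_cst_mul (c : R⟦X⟧) (hc : der d c = 0) (A : DiffOp d) (k : ℤ) :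
    (cst c * A).coeff k = c * A.coeff k := by
  rw [cst, coeff_single_mul, halfShift_const hc, halfShift_zero, sub_zero]

theorem coeff_mul_cst (c : R⟦X⟧) (hc : der d c = 0) (A : DiffOp d) (k : ℤ) :
    (A * cst c).coeff k = A.coeff k * c := by
  rw [cst, coeff_mul_single, halfShift_const hc, neg_zero, halfShift_zero, sub_zero]

theorem cst_comm {c : R⟦X⟧} (hc : der d c = 0) (A : DiffOp d) : cst c * A = A * cst c := by
  ext1
  funext k
  rw [coeff_cst_mul c hc, coeff_mul_cst c hc, mul_comm]

theorem res_cst_mul_congr {c : R⟦X⟧} (hc : der d c = 0) {A B : DiffOp d} (h : res A = res B) :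
    res (cst c * A) = res (cst c * B) := by
  rw [res_eq_iff] at *
  rw [coeff_cst_mul c hc, coeff_cst_mul c hc, ← mul_sub]
  exact const_mul_mem_exact hc h

theorem res_cst_mul_eq_zero {c : R⟦X⟧} (hc : der d c = 0) {A : DiffOp d} (h : res A = 0) :
    res (cst c * A) = 0 := by
  rw [res_cst_mul_congr hc (B := 0) (by rw [h, map_zero]), mul_zero, map_zero]

/-! ### Derivations of the algebra of difference operators -/

theorem iter_comm {δ : Derivation ℚ R R} (hδ : ∀ x, δ (d x) = d (δ x)) (n : ℕ) (x : R) :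
    δ (d^[n] x) = d^[n] (δ x) := by
  induction n with
  | zero => rfl
  | succ n ih => rw [Function.iterate_succ_apply', hδ, ih, Function.iterate_succ_apply']

theorem der_op_comm {δ : Derivation ℚ R R} (hδ : ∀ x, δ (d x) = d (δ x)) (φ : ℚ⟦X⟧)
    (f : R⟦X⟧) : der δ (op d φ f) = op d φ (der δ f) := by
  ext n
  simp only [der, PowerSeries.coeff_mk, coeff_op, map_sum]
  refine Finset.sum_congr rfl fun p _ => ?_
  rw [map_rat_smul, iter_comm hδ]

theorem der_der_comm {δ : Derivation ℚ R R} (hδ : ∀ x, δ (d x) = d (δ x)) (f : R⟦X⟧) :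
    der δ (der d f) = der d (der δ f) := by
  ext n
  simp [der, hδ]

/-- The derivation `∑ aₖ Λᵏ ↦ ∑ (δ aₖ + κ k aₖ) Λᵏ`. -/
def variation (δ : Derivation ℚ R R) (κ : ℚ) : DiffOp d →+ DiffOp d where
  toFun A := ⟨fun k => der δ (A.coeff k) + (κ * k) • A.coeff k, by
    obtain ⟨N, hN⟩ := A.bdd
    exact ⟨N, fun k hk => by rw [hN k hk, der_zero, smul_zero, add_zero]⟩⟩
  map_zero' := by
    ext1
    funext k
    simp [der_zero]
  map_add' A B := by
    ext1
    funext k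
    simp only [coeff_add, der_add, smul_add]
    abel

theorem coeff_variation (δ : Derivation ℚ R R) (κ : ℚ) (A : DiffOp d) (k : ℤ) :
    (variation δ κ A).coeff k = der δ (A.coeff k) + (κ * k) • A.coeff k := rfl

theorem variation_order {δ : Derivation ℚ R R} {κ : ℚ} {A : DiffOp d} {N : ℤ}
    (hA : ∀ k, N < k → A.coeff k = 0) : ∀ k, N < k → (variation δ κ A).coeff k = 0 := by
  intro k hk
  rw [coeff_variation, hA k hk, der_zero, smul_zero, add_zero]

/-- Both summands are derivations: $\delta$ commutes with the half shifts, and the degree in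
$\Lambda$ is additive. The parameter $\kappa$ lets one trace computation serve the grading
derivation ($\delta=0$, $\kappa=1$) and the genuine variations ($\kappa=0$). -/
theorem variation_mul {δ : Derivation ℚ R R} (hδ : ∀ x, δ (d x) = d (δ x)) (κ : ℚ)
    (A B : DiffOp d) :
    variation δ κ (A * B) = variation δ κ A * B + A * variation δ κ B := by
  obtain ⟨N, hN⟩ := A.bdd
  obtain ⟨M, hM⟩ := B.bdd
  ext1
  funext k
  rw [coeff_add, coeff_mul_eq_sum (variation_order hN) hM k (Finset.Subset.refl _),
    coeff_mul_eq_sum hN (variation_order hM) k (Finset.Subset.refl _), ← Finset.sum_add_distrib,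
    coeff_variation, coeff_mul_eq_sum hN hM k (Finset.Subset.refl _), der_sum, Finset.smul_sum,
    ← Finset.sum_add_distrib]
  refine Finset.sum_congr rfl fun i _ => ?_
  simp only [mulTerm, coeff_variation, map_add, der_mul, halfShift_eq_op, der_op_comm hδ]
  have hs : ∀ (φ : ℚ⟦X⟧) (c : ℚ) (f : R⟦X⟧), op d φ (c • f) = c • op d φ f := fun φ c f =>
    map_rat_smul _ _ _
  simp only [hs, add_mul, mul_add, smul_mul_assoc, mul_smul_comm]
  push_cast
  module

theorem variation_one {δ : Derivation ℚ R R} {κ : ℚ} : variation δ κ (1 : DiffOp d) = 0 := by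
  ext1
  funext k
  rw [coeff_variation, DiffOp.coeff_one]
  split_ifs with h
  · simp [h, der_one]
  · simp [der_zero]

theorem variation_cst_mul {δ : Derivation ℚ R R} {κ : ℚ} {c : R⟦X⟧} (hc : der d c = 0)
    (hc' : der δ c = 0) (A : DiffOp d) :
    variation δ κ (cst c * A) = cst c * variation δ κ A := by
  ext1
  funext k
  rw [coeff_variation, coeff_cst_mul c hc, coeff_cst_mul c hc, coeff_variation, der_mul, hc',
    zero_mul, zero_add, mul_add, mul_smul_comm]

theorem variation_single_one (δ : Derivation ℚ R R) (κ : ℚ) (j : ℤ) :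
    variation δ κ (single j 1 : DiffOp d) = cst (algebraMap ℚ R⟦X⟧ (κ * j)) * single j 1 := by
  have hc : der d (algebraMap ℚ R⟦X⟧ (κ * j)) = 0 := by
    rw [Algebra.algebraMap_eq_smul_one, der_smul, der_one, smul_zero]
  ext1
  funext k
  rw [coeff_variation, coeff_cst_mul _ hc, coeff_single]
  split_ifs with h
  · simp [h, der_one, Algebra.algebraMap_eq_smul_one]
  · simp [der_zero]

/-- By cyclicity of the trace, every term of the Leibniz expansion can be rotated until the varied
factor comes first; the remaining factors commute, so all terms agree. -/
theorem res_variation_pow_mul {δ : Derivation ℚ R R} (hδ : ∀ x, δ (d x) = d (δ x)) (κ : ℚ)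
    {A B : DiffOp d} (hAB : Commute A B) (m : ℕ) :
    res (variation δ κ (A ^ (m + 1)) * B) = (m + 1 : ℚ) • res (variation δ κ A * (A ^ m * B)) := by
  induction m generalizing B with
  | zero => simp
  | succ m ih =>
    rw [pow_succ, variation_mul hδ, add_mul, map_add, mul_assoc _ A B,
      ih ((Commute.refl A).mul_right hAB), mul_assoc (A ^ (m + 1)), res_mul_comm (A ^ (m + 1)),
      mul_assoc _ B, ← (hAB.pow_left (m + 1)).eq, ← mul_assoc (A ^ m), ← pow_succ]
    push_cast
    module

/-! ### Monic operators -/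

theorem monic_pow {A : DiffOp d} {r : ℤ} (h1 : A.coeff r = 1)
    (h : ∀ k, r < k → A.coeff k = 0) (n : ℕ) :
    (A ^ n).coeff (n * r) = 1 ∧ ∀ k : ℤ, n * r < k → (A ^ n).coeff k = 0 := by
  induction n with
  | zero =>
    rw [pow_zero]
    refine ⟨by simp [DiffOp.coeff_one], fun k hk => ?_⟩
    rw [DiffOp.coeff_one, if_neg (by push_cast at hk; omega)]
  | succ n ih =>
    rw [pow_succ]
    push_cast
    rw [add_mul, one_mul]
    refine ⟨?_, fun k hk => coeff_mul_eq_zero ih.2 h k hk⟩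
    rw [coeff_mul_top ih.2 h, ih.1, h1, map_one, map_one, mul_one]

theorem pow_order {A : DiffOp d} {r : ℤ} (h : ∀ k, r < k → A.coeff k = 0) (n : ℕ) (k : ℤ)
    (hk : n * r < k) : (A ^ n).coeff k = 0 := by
  induction n generalizing k with
  | zero =>
    rw [pow_zero, DiffOp.coeff_one, if_neg (by push_cast at hk; omega)]
  | succ n ih =>
    rw [pow_succ]
    push_cast at hk
    rw [add_mul, one_mul] at hk
    exact coeff_mul_eq_zero ih h k hk

theorem single_mul_single_one (i j : ℤ) :
    (single i 1 : DiffOp d) * single j 1 = single (i + j) 1 := by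
  ext1
  funext k
  rw [coeff_single_mul, map_one, one_mul, coeff_single, coeff_single]
  by_cases h : k = i + j
  · rw [if_pos h, if_pos (by omega), map_one]
  · rw [if_neg h, if_neg (by omega), map_zero]

theorem single_zero_one : (single 0 1 : DiffOp d) = 1 := rfl

theorem single_one_pow (i : ℤ) (n : ℕ) : (single i 1 : DiffOp d) ^ n = single (n * i) 1 := by
  induction n with
  | zero => simp [single_zero_one]
  | succ n ih =>
    rw [pow_succ, ih, single_mul_single_one]
    congr 1
    push_cast
    ring

theorem single_order (i : ℤ) (a : R⟦X⟧) : ∀ k, i < k → (single i a : DiffOp d).coeff k = 0 :=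
  fun k hk => by rw [coeff_single, if_neg (by omega)]

/-- The geometric series `∑ Nᵏ` of an operator of negative order. -/
def geomSeries (N : DiffOp d) : DiffOp d :=
  ⟨fun k => (∑ j ∈ Finset.range ((-k).toNat + 1), N ^ j).coeff k, 0, fun k hk => by
    rw [show (-k).toNat = 0 by omega]
    simp [DiffOp.coeff_one, show k ≠ 0 by omega]⟩

theorem coeff_sum {ι : Type*} (s : Finset ι) (f : ι → DiffOp d) (k : ℤ) :
    (∑ i ∈ s, f i).coeff k = ∑ i ∈ s, (f i).coeff k :=
  map_sum (coeffHom k) f s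

theorem geomSeries_coeff {N : DiffOp d} (hN : ∀ k, -1 < k → N.coeff k = 0) (M : ℕ) (k : ℤ)
    (hk : -(M : ℤ) ≤ k) :
    (geomSeries N).coeff k = (∑ j ∈ Finset.range (M + 1), N ^ j).coeff k := by
  rw [coeff_sum]
  change (∑ j ∈ Finset.range ((-k).toNat + 1), N ^ j).coeff k = _
  rw [coeff_sum]
  refine Finset.sum_subset (Finset.range_mono (by omega)) fun j _ hj => ?_
  rw [Finset.mem_range] at hj
  exact pow_order hN j k (by omega)

theorem geomSeries_mul {N : DiffOp d} (hN : ∀ k, -1 < k → N.coeff k = 0) :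
    geomSeries N * (1 - N) = 1 ∧ (1 - N) * geomSeries N = 1 := by
  have h1N : ∀ k, 0 < k → (1 - N).coeff k = 0 := fun k hk => by
    rw [coeff_sub, DiffOp.coeff_one, if_neg (by omega), hN k (by omega), sub_zero]
  have hd : ∀ (M : ℕ) (k : ℤ), -(M + 1 : ℤ) < k →
      (geomSeries N - ∑ j ∈ Finset.range (M + 1), N ^ j).coeff k = 0 := fun M k hk => by
    rw [coeff_sub, geomSeries_coeff hN M k (by omega), sub_self]
  have hpow : ∀ (M : ℕ) (k : ℤ), -(M + 1 : ℤ) < k → (N ^ (M + 1)).coeff k = 0 := fun M k hk =>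
    pow_order hN _ _ (by push_cast; omega)
  constructor
  · ext1
    funext k
    -- The truncation depends on the coefficient inspected: what lies beyond $N^M$ has order at most
    -- $-(M+1)<k$.
    set M := (-k).toNat
    have e : geomSeries N * (1 - N) =
        (geomSeries N - ∑ j ∈ Finset.range (M + 1), N ^ j) * (1 - N) + (1 - N ^ (M + 1)) := by
      rw [sub_mul, geom_sum_mul_neg, sub_add_cancel]
    rw [e, coeff_add, coeff_mul_eq_zero (hd M) h1N k (by omega), coeff_sub, hpow M k (by omega)]
    simp
  · ext1
    funext k
    set M := (-k).toNat
    have e : (1 - N) * geomSeries N =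
        (1 - N) * (geomSeries N - ∑ j ∈ Finset.range (M + 1), N ^ j) + (1 - N ^ (M + 1)) := by
      rw [mul_sub, mul_neg_geom_sum, sub_add_cancel]
    rw [e, coeff_add, coeff_mul_eq_zero h1N (hd M) k (by omega), coeff_sub, hpow M k (by omega)]
    simp

/-- Factor $L=(1-N)\Lambda$ with $N=1-L\Lambda^{-1}$ of negative order; then $\Lambda^{-1}\sum_jN^j$
is a two-sided inverse. -/
theorem exists_inverse {L : DiffOp d} (h1 : L.coeff 1 = 1) (h : ∀ k, 1 < k → L.coeff k = 0) :
    ∃ Y : DiffOp d, L * Y = 1 ∧ Y * L = 1 ∧ Y.coeff (-1) = 1 ∧ ∀ k, -1 < k → Y.coeff k = 0 := by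
  set N : DiffOp d := 1 - L * single (-1) 1 with hNdef
  have hN : ∀ k, -1 < k → N.coeff k = 0 := fun k hk => by
    rw [hNdef, coeff_sub, coeff_mul_single, map_one, mul_one, neg_neg, DiffOp.coeff_one]
    rcases (show k = 0 ∨ 0 < k by omega) with rfl | hk'
    · simp [h1]
    · rw [if_neg (by omega), show k - -1 = k + 1 by ring, h _ (by omega), map_zero, sub_zero]
  obtain ⟨e1, e2⟩ := geomSeries_mul hN
  have hL : L = (1 - N) * single 1 1 := by
    rw [hNdef, sub_sub_cancel, mul_assoc, single_mul_single_one, neg_add_cancel, single_zero_one,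
      mul_one]
  have hG0 : (geomSeries N).coeff 0 = 1 := by
    rw [geomSeries_coeff hN 0 0 (by simp)]
    simp [DiffOp.coeff_one]
  refine ⟨single (-1) 1 * geomSeries N, ?_, ?_, ?_, fun k hk => ?_⟩
  · rw [hL, mul_assoc, ← mul_assoc (single 1 1), single_mul_single_one, add_neg_cancel,
      single_zero_one, one_mul, e2]
  · rw [hL, mul_assoc, ← mul_assoc (geomSeries N), e1, one_mul, single_mul_single_one,
      neg_add_cancel, single_zero_one]
  · rw [coeff_single_mul, map_one, one_mul, sub_self, hG0, map_one]
  · have : (geomSeries N).coeff (k - -1) = 0 := by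
      rw [geomSeries_coeff hN 0 _ (by push_cast; omega)]
      rw [zero_add, Finset.sum_range_one, pow_zero, DiffOp.coeff_one, if_neg (by omega)]
    rw [coeff_single_mul, this, map_zero, mul_zero]

end TraceCalculus

end EqToda

namespace EqToda

/-! ### Logarithms as linear coefficients of powers -/

noncomputable section LinearCoefficients

open DiffOp

/-! ### Sequences depending polynomially on their index, and their linear coefficients -/

section Sequences

variable {R : Type*} [CommRing R]

/-- The sequence `f` is polynomial, with linear coefficient `c`. -/
def HasLinear (f : ℕ → R) (c : R) : Prop :=
  ∃ p : Polynomial R, (∀ m : ℕ, f m = p.eval (m : R)) ∧ p.coeff 1 = c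

theorem HasLinear.const (x : R) : HasLinear (fun _ => x) 0 :=
  ⟨Polynomial.C x, fun m => by simp, by simp⟩

theorem HasLinear.add {f g : ℕ → R} {a b : R} (hf : HasLinear f a) (hg : HasLinear g b) :
    HasLinear (fun m => f m + g m) (a + b) := by
  obtain ⟨p, hp, rfl⟩ := hf
  obtain ⟨q, hq, rfl⟩ := hg
  exact ⟨p + q, fun m => by simp [hp, hq], by simp⟩

theorem HasLinear.sum {ι : Type*} (s : Finset ι) {f : ι → ℕ → R} {a : ι → R}
    (h : ∀ i ∈ s, HasLinear (f i) (a i)) :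
    HasLinear (fun m => ∑ i ∈ s, f i m) (∑ i ∈ s, a i) := by
  classical
  induction s using Finset.induction_on with
  | empty => simpa using HasLinear.const (0 : R)
  | insert i s hi ih =>
    simp only [Finset.sum_insert hi]
    exact (h i (Finset.mem_insert_self i s)).add
      (ih fun j hj => h j (Finset.mem_insert_of_mem hj))

theorem HasLinear.mul {f g : ℕ → R} {a b : R} (hf : HasLinear f a) (hg : HasLinear g b) :
    HasLinear (fun m => f m * g m) (a * g 0 + f 0 * b) := by
  obtain ⟨p, hp, rfl⟩ := hf
  obtain ⟨q, hq, rfl⟩ := hg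
  refine ⟨p * q, fun m => by simp [hp, hq], ?_⟩
  rw [hp, hq, Nat.cast_zero, ← Polynomial.coeff_zero_eq_eval_zero,
    ← Polynomial.coeff_zero_eq_eval_zero, Polynomial.mul_coeff_one]
  ring

/-- The coefficients of the sequence `f` of series are polynomial, with linear coefficients the
coefficients of `c`. -/
def SeriesHasLinear (f : ℕ → R⟦X⟧) (c : R⟦X⟧) : Prop :=
  ∀ n, HasLinear (fun m => PowerSeries.coeff n (f m)) (PowerSeries.coeff n c)

theorem SeriesHasLinear.const (x : R⟦X⟧) : SeriesHasLinear (fun _ => x) 0 := fun n => by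
  simpa using HasLinear.const (PowerSeries.coeff n x)

theorem SeriesHasLinear.sum {ι : Type*} (s : Finset ι) {f : ι → ℕ → R⟦X⟧} {a : ι → R⟦X⟧}
    (h : ∀ i ∈ s, SeriesHasLinear (f i) (a i)) :
    SeriesHasLinear (fun m => ∑ i ∈ s, f i m) (∑ i ∈ s, a i) := fun n => by
  simpa using HasLinear.sum s fun i hi => h i hi n

theorem SeriesHasLinear.add {f g : ℕ → R⟦X⟧} {a b : R⟦X⟧} (hf : SeriesHasLinear f a)
    (hg : SeriesHasLinear g b) : SeriesHasLinear (fun m => f m + g m) (a + b) := fun n => by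
  simpa using (hf n).add (hg n)

theorem SeriesHasLinear.mul {f g : ℕ → R⟦X⟧} {a b : R⟦X⟧} (hf : SeriesHasLinear f a)
    (hg : SeriesHasLinear g b) : SeriesHasLinear (fun m => f m * g m) (a * g 0 + f 0 * b) := by
  intro n
  simp only [map_add, PowerSeries.coeff_mul, ← Finset.sum_add_distrib]
  exact HasLinear.sum _ fun p _ => (hf p.1).mul (hg p.2)

variable [Algebra ℚ R]

/-- The map is only additive, not multiplicative, but the points of evaluation are natural numbers,
so it may be applied to the coefficients of the polynomial. -/
theorem HasLinear.map {S : Type*} [CommRing S] [Algebra ℚ S] (D : R →ₗ[ℚ] S) {f : ℕ → R} {a : R}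
    (hf : HasLinear f a) : HasLinear (fun m => D (f m)) (D a) := by
  obtain ⟨p, hp, rfl⟩ := hf
  simp only [hp]
  clear hp f
  induction p using Polynomial.induction_on' with
  | add p q hp hq => simpa using hp.add hq
  | monomial n x =>
    refine ⟨Polynomial.monomial n (D x), fun m => ?_, ?_⟩
    · beta_reduce
      rw [Polynomial.eval_monomial, Polynomial.eval_monomial, ← Nat.cast_pow, ← Nat.cast_pow,
        mul_comm, ← nsmul_eq_mul, map_nsmul, nsmul_eq_mul, mul_comm]
    · rw [Polynomial.coeff_monomial, Polynomial.coeff_monomial]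
      split_ifs <;> simp

/-- Linear functionals separate the points of the $\mathbb Q$-space $R/S$. Under a functional the
sequence becomes a rational polynomial equal to a linear one at all natural numbers, hence
identically. -/
theorem HasLinear.sub_mem {f : ℕ → R} {a h : R} (hf : HasLinear f a) (S : Submodule ℚ R)
    (hS : ∀ m : ℕ, f m - (m : ℚ) • h ∈ S) : a - h ∈ S := by
  rw [← Submodule.Quotient.eq, ← Submodule.mkQ_apply, ← Submodule.mkQ_apply]
  refine eq_of_sub_eq_zero ((Module.forall_dual_apply_eq_zero_iff ℚ _).1 fun l => ?_)
  obtain ⟨p, hp, hp1⟩ := hf.map (l ∘ₗ S.mkQ)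
  have hpX : p = Polynomial.C (l (S.mkQ h)) * Polynomial.X := by
    refine Polynomial.eq_of_infinite_eval_eq _ _
      ((Set.infinite_range_of_injective (Nat.cast_injective (R := ℚ))).mono ?_)
    rintro _ ⟨m, rfl⟩
    have := (Submodule.Quotient.eq S).2 (hS m)
    rw [← Submodule.mkQ_apply, ← Submodule.mkQ_apply, map_smul] at this
    change p.eval (m : ℚ) = _
    rw [← hp]
    change l (S.mkQ (f m)) = _
    rw [this, map_smul, smul_eq_mul, Polynomial.eval_mul, Polynomial.eval_C, Polynomial.eval_X,
      mul_comm]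
  rw [map_sub, ← LinearMap.comp_apply, ← hp1, hpX]
  simp

theorem HasLinear.unique {f : ℕ → R} {a b : R} (hf : HasLinear f a) (hg : HasLinear f b) :
    a = b := by
  have h1 := hf.add (hg.map (-LinearMap.id))
  -- The difference of the two presentations is the zero sequence, with linear coefficient $a-b$.
  have h2 := h1.sub_mem (h := 0) ⊥ fun m => by simp
  simpa [sub_eq_zero, ← sub_eq_add_neg] using h2

theorem hasLinear_rat {g : ℕ → ℚ} {c : ℚ} (hg : HasLinear g c) (x : R) :
    HasLinear (fun m => g m • x) (c • x) :=
  hg.map ((LinearMap.id (R := ℚ) (M := ℚ)).smulRight x)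

theorem hasLinear_choose (k : ℕ) : ∃ c, HasLinear (fun m => (m.choose k : ℚ)) c := by
  refine ⟨_, Polynomial.C (1 / (k.factorial : ℚ)) * descPochhammer ℚ k, fun m => ?_, rfl⟩
  rw [Polynomial.eval_mul, Polynomial.eval_C, descPochhammer_eval_eq_descFactorial,
    Nat.descFactorial_eq_factorial_mul_choose]
  have : (k.factorial : ℚ) ≠ 0 := by positivity
  push_cast
  field_simp

theorem SeriesHasLinear.unique {f : ℕ → R⟦X⟧} {a b : R⟦X⟧} (hf : SeriesHasLinear f a)
    (hg : SeriesHasLinear f b) : a = b := by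
  ext n
  exact (hf n).unique (hg n)

theorem SeriesHasLinear.smul {f : ℕ → R⟦X⟧} {a : R⟦X⟧} (hf : SeriesHasLinear f a) (c : ℚ) :
    SeriesHasLinear (fun m => c • f m) (c • a) := fun n => by
  simp only [PowerSeries.coeff_smul]
  exact (hf n).map (c • (LinearMap.id : R →ₗ[ℚ] R))

theorem SeriesHasLinear.der (δ : Derivation ℚ R R) {f : ℕ → R⟦X⟧} {a : R⟦X⟧}
    (hf : SeriesHasLinear f a) : SeriesHasLinear (fun m => der δ (f m)) (der δ a) := fun n => by
  simpa [EqToda.der] using (hf n).map δ.toLinearMap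

theorem SeriesHasLinear.op (d : Derivation ℚ R R) (φ : ℚ⟦X⟧) {f : ℕ → R⟦X⟧} {a : R⟦X⟧}
    (hf : SeriesHasLinear f a) : SeriesHasLinear (fun m => op d φ (f m)) (op d φ a) := by
  intro n
  simp only [coeff_op]
  refine HasLinear.sum _ fun p _ => ?_
  have := (hf p.2).map (PowerSeries.coeff p.1 φ • d.toLinearMap ^ p.1)
  simpa [Module.End.pow_apply] using this

theorem SeriesHasLinear.halfShift (d : Derivation ℚ R R) (k : ℤ) {f : ℕ → R⟦X⟧} {a : R⟦X⟧}
    (hf : SeriesHasLinear f a) :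
    SeriesHasLinear (fun m => halfShift d k (f m)) (halfShift d k a) := by
  simp only [halfShift_eq_op]
  exact hf.op d _

theorem hasLinear_pow (i : ℕ) : HasLinear (fun m => (m : ℚ) ^ i) (if i = 1 then 1 else 0) :=
  ⟨Polynomial.X ^ i, fun m => by simp, by simp [Polynomial.coeff_X_pow, eq_comm]⟩

/-- The part of $\mathsf E^m=\exp(m\varepsilon\partial)$ linear in $m$ is $\varepsilon\partial$; the
index $2m$ appears because half steps are counted. -/
theorem seriesHasLinear_halfShift (d : Derivation ℚ R R) (f : R⟦X⟧) :
    SeriesHasLinear (fun m => halfShift d (2 * m) f) (PowerSeries.X * der d f) := by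
  intro n
  rw [← op_X]
  simp only [halfShift_eq_op, coeff_op]
  refine HasLinear.sum _ fun p _ => ?_
  have := hasLinear_rat (hasLinear_pow p.1) ((1 / p.1.factorial : ℚ) •
    (d^[p.1] (PowerSeries.coeff p.2 f)))
  convert this using 1
  · funext m
    rw [coeff_expSeries, smul_smul]
    congr 1
    push_cast
    ring
  · rw [PowerSeries.coeff_X]
    split_ifs with h <;> simp [h]

theorem SeriesHasLinear.sub_mem_exact {d : Derivation ℚ R R} {f : ℕ → R⟦X⟧} {a h : R⟦X⟧}
    (hf : SeriesHasLinear f a) (he : ∀ m : ℕ, f m - (m : ℚ) • h ∈ exact d) : a - h ∈ exact d := by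
  have key : ∀ n, ∃ g, d g = PowerSeries.coeff n (a - h) := fun n => by
    have := (hf n).sub_mem (h := PowerSeries.coeff n h) (LinearMap.range d.toLinearMap) fun m => by
      obtain ⟨g, hg⟩ := he m
      refine ⟨PowerSeries.coeff n g, ?_⟩
      have := congrArg (PowerSeries.coeff n) hg
      simpa [derLin, EqToda.der] using this
    obtain ⟨g, hg⟩ := this
    exact ⟨g, by simpa using hg⟩
  choose g hg using key
  refine ⟨PowerSeries.mk g, ?_⟩
  ext n
  simp [derLin, EqToda.der, hg]

end Sequences

/-! ### Polynomial sequences of difference operators -/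

variable {R : Type*} [CommRing R] [Algebra ℚ R] {d : Derivation ℚ R R}

/-- The coefficients of the sequence `F` of difference operators of bounded order are polynomial,
with linear coefficients the coefficients of `A`. -/
structure OpHasLinear (F : ℕ → DiffOp d) (A : DiffOp d) : Prop where
  bdd : ∃ N : ℤ, ∀ m k, N < k → (F m).coeff k = 0
  coeff : ∀ k, SeriesHasLinear (fun m => (F m).coeff k) (A.coeff k)

theorem OpHasLinear.order {F : ℕ → DiffOp d} {A : DiffOp d} (h : OpHasLinear F A) {N : ℤ}
    (hF : ∀ m k, N < k → (F m).coeff k = 0) (k : ℤ) (hk : N < k) : A.coeff k = 0 := by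
  have h1 := h.coeff k
  simp only [hF _ k hk] at h1
  exact h1.unique (SeriesHasLinear.const 0)

theorem OpHasLinear.unique {F : ℕ → DiffOp d} {A B : DiffOp d} (hA : OpHasLinear F A)
    (hB : OpHasLinear F B) : A = B := by
  ext1
  funext k
  exact (hA.coeff k).unique (hB.coeff k)

theorem OpHasLinear.const (A : DiffOp d) : OpHasLinear (fun _ => A) 0 :=
  ⟨A.bdd.imp fun _ h _ => h, fun _ => SeriesHasLinear.const _⟩

/-- The Leibniz rule for the derivative in $m$ at $m=0$. The uniform bound on the orders keeps each
coefficient of the product a fixed finite sum. -/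
theorem OpHasLinear.mul {F G : ℕ → DiffOp d} {A B : DiffOp d} (hF : OpHasLinear F A)
    (hG : OpHasLinear G B) : OpHasLinear (fun m => F m * G m) (A * G 0 + F 0 * B) := by
  obtain ⟨N, hN⟩ := hF.bdd
  obtain ⟨M, hM⟩ := hG.bdd
  refine ⟨⟨N + M, fun m k hk => coeff_mul_eq_zero (hN m) (hM m) k hk⟩, fun k => ?_⟩
  simp only [coeff_mul_eq_sum (hN _) (hM _) k (Finset.Subset.refl _)]
  rw [coeff_add, coeff_mul_eq_sum (hF.order hN) (hM 0) k (Finset.Subset.refl _),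
    coeff_mul_eq_sum (hN 0) (hG.order hM) k (Finset.Subset.refl _), ← Finset.sum_add_distrib]
  exact SeriesHasLinear.sum _ fun i _ =>
    ((hF.coeff i).halfShift d _).mul ((hG.coeff (k - i)).halfShift d _)

theorem OpHasLinear.variation (δ : Derivation ℚ R R) (κ : ℚ) {F : ℕ → DiffOp d} {A : DiffOp d}
    (hF : OpHasLinear F A) :
    OpHasLinear (fun m => variation δ κ (F m)) (variation δ κ A) := by
  obtain ⟨N, hN⟩ := hF.bdd
  exact ⟨⟨N, fun m => variation_order (hN m)⟩,
    fun k => ((hF.coeff k).der δ).add ((hF.coeff k).smul _)⟩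

/-- Transfers trace identities from powers to the logarithm: they need checking only for natural
$m$, where the trace is visibly proportional to $m$. -/
theorem OpHasLinear.res_eq {F : ℕ → DiffOp d} {A : DiffOp d} (hF : OpHasLinear F A)
    {x : R⟦X⟧ ⧸ exact d} (h : ∀ m : ℕ, res (F m) = (m : ℚ) • x) : res A = x := by
  obtain ⟨y, rfl⟩ := (exact d).mkQ_surjective x
  refine (Submodule.Quotient.eq _).2 ?_
  refine (hF.coeff 0).sub_mem_exact fun m => ?_
  rw [← Submodule.Quotient.eq]
  exact h m

/-! ### Existence of the linear coefficients of conjugated powers -/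

/-- The coefficient of `Λⁱ` in `A` is divisible by `ε^{k+i}`. -/
def Deep (k : ℤ) (A : DiffOp d) : Prop :=
  ∀ i : ℤ, (PowerSeries.X : R⟦X⟧) ^ (k + i).toNat ∣ A.coeff i

theorem X_pow_dvd_halfShift {n : ℕ} {f : R⟦X⟧} (h : PowerSeries.X ^ n ∣ f) (k : ℤ) :
    PowerSeries.X ^ n ∣ halfShift d k f := by
  have := map_dvd (halfShift d k) h
  rwa [map_pow, halfShift_const (der_X d)] at this

theorem X_dvd_halfShift_sub (k : ℤ) (f : R⟦X⟧) : PowerSeries.X ∣ halfShift d k f - f := by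
  rw [PowerSeries.X_dvd_iff, map_sub, sub_eq_zero,
    ← PowerSeries.coeff_zero_eq_constantCoeff_apply,
    ← PowerSeries.coeff_zero_eq_constantCoeff_apply, halfShift_eq_op, coeff_op]
  simp [coeff_expSeries]

theorem Deep.add {k : ℤ} {A B : DiffOp d} (hA : Deep k A) (hB : Deep k B) : Deep k (A + B) :=
  fun i => dvd_add (hA i) (hB i)

/-- Depth measures $\varepsilon$-adic order against the degree in $\Lambda$. A factor of order at
most $r$ raises the degree by at most $r$, so it costs at most $r$; a factor of negative order
increases depth. -/
theorem Deep.mul_left {k : ℤ} {A B : DiffOp d} (hA : Deep k A) {r : ℤ}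
    (hB : ∀ j, r < j → B.coeff j = 0) : Deep (k - r) (B * A) := by
  intro i
  obtain ⟨N, hN⟩ := A.bdd
  rw [coeff_mul_eq_sum hB hN i (Finset.Subset.refl _)]
  refine Finset.dvd_sum fun j hj => Dvd.dvd.mul_left (X_pow_dvd_halfShift ?_ _) _
  rw [Finset.mem_Icc] at hj
  exact (pow_dvd_pow _ (by omega)).trans (hA (i - j))

theorem Deep.mul_right {k : ℤ} {A B : DiffOp d} (hA : Deep k A) {r : ℤ}
    (hB : ∀ j, r < j → B.coeff j = 0) : Deep (k - r) (A * B) := by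
  intro i
  obtain ⟨N, hN⟩ := A.bdd
  rw [coeff_mul_eq_sum hN hB i (Finset.Subset.refl _)]
  refine Finset.dvd_sum fun j hj => Dvd.dvd.mul_right (X_pow_dvd_halfShift ?_ _) _
  rw [Finset.mem_Icc] at hj
  exact (pow_dvd_pow _ (by omega)).trans (hA j)

theorem coeff_conj_single (A : DiffOp d) (n : ℤ) (k : ℤ) :
    (single n 1 * A * single (-n) 1).coeff k = halfShift d (2 * n) (A.coeff k) := by
  rw [coeff_mul_single, coeff_single_mul, map_one, map_one, mul_one, one_mul, halfShift_halfShift]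
  congr 2 <;> ring

/-- Replacing $X$ and $Z$ by their leading terms leaves $\Lambda A\Lambda^{-1}-A$, which gains a
factor $\varepsilon$ because $\mathsf E\equiv1$ modulo $\varepsilon$. Each of the two corrections
lowers the degree in $\Lambda$ by one, which also gains one unit of depth. -/
theorem Deep.conj_sub {k : ℤ} {A X Z : DiffOp d} (hA : Deep k A)
    (hX1 : X.coeff 1 = 1) (hX : ∀ j, 1 < j → X.coeff j = 0)
    (hZ1 : Z.coeff (-1) = 1) (hZ : ∀ j, -1 < j → Z.coeff j = 0) :
    Deep (k + 1) (X * A * Z - A) := by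
  have e : X * A * Z - A = (single 1 1 * A * single (-1) 1 - A) + (X - single 1 1) * A * Z
      + single 1 1 * A * (Z - single (-1) 1) := by
    noncomm_ring
  rw [e]
  refine (Deep.add ?_ ?_).add ?_
  · intro i
    rw [coeff_sub, coeff_conj_single]
    obtain ⟨g, hg⟩ := hA i
    rw [hg, map_mul, map_pow, halfShift_const (der_X d), ← mul_sub]
    refine (pow_dvd_pow _ (show (k + 1 + i).toNat ≤ (k + i).toNat + 1 by omega)).trans ?_
    rw [pow_succ]
    exact mul_dvd_mul_left _ (X_dvd_halfShift_sub _ _)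
  · have := (hA.mul_left (B := X - single 1 1) (r := 0) fun j hj => ?_).mul_right hZ
    · simpa using this
    · rw [coeff_sub, coeff_single]
      split_ifs with h
      · rw [h, hX1, sub_self]
      · rw [hX j (by omega), sub_zero]
  · have := (hA.mul_left (single_order 1 1)).mul_right (B := Z - single (-1) 1) (r := -2)
      fun j hj => ?_
    · rwa [show k - 1 - -2 = k + 1 by ring] at this
    · rw [coeff_sub, coeff_single]
      split_ifs with h
      · rw [h, hZ1, sub_self]
      · rw [hZ j (by omega), sub_zero]

/-- With $T(A)=XAZ$, one has $X^mZ^m=T^m(1)=\sum_k\binom mk(T-1)^k(1)$. By `Deep.conj_sub` the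
$k$-th term has depth $k$, so each $\varepsilon$-coefficient of each $\Lambda^i$ receives only
finitely many binomials, which are polynomial in $m$. -/
theorem exists_opHasLinear {X Z : DiffOp d}
    (hX1 : X.coeff 1 = 1) (hX : ∀ j, 1 < j → X.coeff j = 0)
    (hZ1 : Z.coeff (-1) = 1) (hZ : ∀ j, -1 < j → Z.coeff j = 0) :
    ∃ A, OpHasLinear (fun m => X ^ m * Z ^ m) A ∧ ∀ k, -1 < k → A.coeff k = 0 := by
  set T : Module.End ℤ (DiffOp d) := LinearMap.mulRight ℤ Z ∘ₗ LinearMap.mulLeft ℤ X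
  have hTapp : ∀ A, T A = X * A * Z := fun _ => rfl
  have hpow : ∀ m, (T ^ m) 1 = X ^ m * Z ^ m := by
    intro m
    induction m with
    | zero => simp
    | succ m ih =>
      rw [pow_succ' T, Module.End.mul_apply, ih, hTapp, pow_succ' X, pow_succ Z]
      noncomm_ring
  have hdeep : ∀ k : ℕ, Deep (d := d) k (((T - 1) ^ k) 1) := by
    intro k
    induction k with
    | zero =>
      intro i
      rw [pow_zero, Module.End.one_apply, DiffOp.coeff_one]
      split_ifs with h
      · simp [h]
      · exact dvd_zero _
    | succ k ih =>
      rw [pow_succ', Module.End.mul_apply]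
      push_cast
      exact ih.conj_sub hX1 hX hZ1 hZ
  have hbinom : ∀ m, X ^ m * Z ^ m =
      ∑ k ∈ Finset.range (m + 1), m.choose k • (((T - 1) ^ k) 1) := by
    intro m
    rw [← hpow]
    conv_lhs => rw [← sub_add_cancel T 1, (Commute.one_right (T - 1)).add_pow]
    rw [LinearMap.sum_apply]
    refine Finset.sum_congr rfl fun k _ => ?_
    rw [one_pow, mul_one, Module.End.mul_apply, Module.End.natCast_apply, map_nsmul]
  have hlin : ∀ (i : ℤ) (n : ℕ), ∃ c,
      HasLinear (fun m => PowerSeries.coeff n ((X ^ m * Z ^ m).coeff i)) c := by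
    intro i n
    choose c hc using hasLinear_choose
    -- Depth $k$ kills the coefficient of $\varepsilon^n\Lambda^i$ as soon as $k+i>n$, so only $k\le
    -- n-i$ can contribute.
    refine ⟨∑ k ∈ Finset.range (((n : ℤ) - i + 1).toNat),
      c k • PowerSeries.coeff n ((((T - 1) ^ k) 1).coeff i), ?_⟩
    · have := HasLinear.sum (Finset.range (((n : ℤ) - i + 1).toNat)) fun k _ =>
        hasLinear_rat (hc k) (PowerSeries.coeff n ((((T - 1) ^ k) 1).coeff i))
      convert this using 2 with m
      rw [hbinom, coeff_sum, map_sum]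
      have hterm : ∀ k, PowerSeries.coeff n ((m.choose k • (((T - 1) ^ k) 1)).coeff i) =
          (m.choose k : ℚ) • PowerSeries.coeff n ((((T - 1) ^ k) 1).coeff i) := fun k => by
        rw [Nat.cast_smul_eq_nsmul]
        exact map_nsmul ((PowerSeries.coeff n).toAddMonoidHom.comp (coeffHom i)) _ _
      simp only [hterm]
      rcases le_total (m + 1) ((n : ℤ) - i + 1).toNat with h | h
      · refine Finset.sum_subset (Finset.range_mono h) fun k _ hk => ?_
        rw [Finset.mem_range, not_lt] at hk
        rw [Nat.choose_eq_zero_of_lt hk, Nat.cast_zero, zero_smul]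
      · refine (Finset.sum_subset (Finset.range_mono h) fun k _ hk => ?_).symm
        rw [Finset.mem_range, not_lt] at hk
        rw [PowerSeries.X_pow_dvd_iff.1 (hdeep k i) n (by omega), smul_zero]
  have hord : ∀ m k, (0 : ℤ) < k → (X ^ m * Z ^ m).coeff k = 0 := fun m k hk =>
    coeff_mul_eq_zero (pow_order hX m) (pow_order hZ m) k (by omega)
  choose c hc using hlin
  have hA : ∀ k, 0 < k → PowerSeries.mk (c k) = 0 := fun k hk => by
    ext n
    have := hc k n
    simp only [hord _ k hk, map_zero] at this
    rw [PowerSeries.coeff_mk, map_zero]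
    exact this.unique (HasLinear.const 0)
  refine ⟨⟨fun k => PowerSeries.mk (c k), 0, hA⟩, ⟨⟨0, hord⟩, fun k n => ?_⟩, fun k hk => ?_⟩
  · simpa using hc k n
  · rcases (show k = 0 ∨ 0 < k by omega) with rfl | hk'
    -- The leading coefficient is $1$ for every $m$, so its linear part vanishes and the logarithm
    -- has order at most $-1$.
    · have h1 : ∀ m, (X ^ m * Z ^ m).coeff 0 = 1 := fun m => by
        have h2 := monic_pow hX1 hX m
        have h3 := monic_pow hZ1 hZ m
        have h4 := coeff_mul_top h2.2 h3.2
        rw [h2.1, h3.1, map_one, map_one, mul_one, mul_one, mul_neg_one,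
          add_neg_cancel] at h4
        exact h4
      ext n
      have := hc 0 n
      simp only [h1] at this
      rw [PowerSeries.coeff_mk, map_zero]
      exact this.unique (HasLinear.const _)
    · exact hA k hk'

end LinearCoefficients

end EqToda

namespace EqToda

/-! ### The logarithmic form of the Lax equation and the variation of the Hamiltonians -/

noncomputable section LaxVariation

open DiffOp

variable {R : Type*} [CommRing R] [Algebra ℚ R] {d : Derivation ℚ R R}

/-! ### The logarithm of a monic operator -/

theorem der_algebraMap (δ : Derivation ℚ R R) (c : ℚ) : der δ (algebraMap ℚ R⟦X⟧ c) = 0 := by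
  rw [Algebra.algebraMap_eq_smul_one, der_smul, der_one, smul_zero]

theorem res_cst_algebraMap_mul (c : ℚ) (A : DiffOp d) :
    res (cst (algebraMap ℚ R⟦X⟧ c) * A) = c • res A := by
  rw [res_apply, coeff_cst_mul _ (der_algebraMap d c), ← Algebra.smul_def, map_smul, res_apply]

theorem res_cst_mul_of_eq_smul {z : R⟦X⟧} (hz : der d z = 0) {c : ℚ} {A B : DiffOp d}
    (h : res A = c • res B) : res (cst z * A) = c • res (cst z * B) := by
  rw [← res_cst_algebraMap_mul] at h ⊢
  rw [res_cst_mul_congr hz h, ← mul_assoc, ← mul_assoc, cst_comm hz]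

theorem res_cst_smul_mul (c : ℚ) {z : R⟦X⟧} (hz : der d z = 0) (A : DiffOp d) :
    res (cst (c • z) * A) = c • res (cst z * A) := by
  rw [res_apply, coeff_cst_mul _ (by rw [der_smul, hz, smul_zero]), res_apply, coeff_cst_mul _ hz,
    smul_mul_assoc, map_smul]

theorem pow_mul_pow_of_le {L Y : DiffOp d} (hYL : Y * L = 1) {a b : ℕ} (h : a ≤ b) :
    Y ^ a * L ^ b = L ^ (b - a) := by
  obtain ⟨c, rfl⟩ := Nat.exists_eq_add_of_le h
  rw [pow_add, ← mul_assoc, pow_mul_pow_eq_one a hYL, one_mul, Nat.add_sub_cancel_left]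

/-- Here $\ell$ stands for $\log L-\varepsilon\partial$, the linear coefficient of
$L^m\Lambda^{-m}$. The trace formula is the rule $\mathrm{Res}(D\log L\cdot
L^n)=\mathrm{Res}(DL\cdot L^{n-1})$; the correction in $\kappa$ comes from the degree of
$\Lambda^{-m}$. -/
theorem exists_log {L Y : DiffOp d} (hLY : L * Y = 1) (hYL : Y * L = 1)
    (h1 : L.coeff 1 = 1) (h : ∀ k, 1 < k → L.coeff k = 0)
    (hY1 : Y.coeff (-1) = 1) (hY : ∀ k, -1 < k → Y.coeff k = 0) :
    ∃ ℓ : DiffOp d, (∀ k, -1 < k → ℓ.coeff k = 0) ∧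
      L * ℓ = ℓ * L + cst PowerSeries.X * derOp L ∧
      ∀ (δ : Derivation ℚ R R) (_ : ∀ x, δ (d x) = d (δ x)) (κ : ℚ) (n : ℕ),
        res (variation δ κ ℓ * L ^ n) =
          res (variation δ κ L * (Y * L ^ n)) - κ • res (L ^ n) := by
  have hΛ1 : (single 1 1 : DiffOp d).coeff 1 = 1 := by simp [coeff_single]
  have hZ1 : (single (-1) 1 : DiffOp d).coeff (-1) = 1 := by simp [coeff_single]
  have hZΛ : (single (-1) 1 : DiffOp d) * single 1 1 = 1 := single_mul_single_one (-1) 1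
  obtain ⟨ℓ, hU, hℓ⟩ := exists_opHasLinear h1 h hZ1 (single_order (-1) 1)
  obtain ⟨B, hV, -⟩ := exists_opHasLinear hΛ1 (single_order 1 1) hY1 hY
  refine ⟨ℓ, hℓ, ?_, fun δ hδ κ n => ?_⟩
  · have e1 := (OpHasLinear.const L).mul hU
    have hσ : OpHasLinear (fun m : ℕ => single 1 1 ^ m * L * single (-1) 1 ^ m)
        (cst PowerSeries.X * derOp L) := by
      have hc : ∀ (m : ℕ) (k : ℤ), (single 1 1 ^ m * L * single (-1) 1 ^ m).coeff k =
          halfShift d (2 * m) (L.coeff k) := fun m k => by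
        rw [single_one_pow, single_one_pow, mul_one, mul_neg_one, coeff_conj_single]
      refine ⟨⟨1, fun m k hk => by rw [hc, h k hk, map_zero]⟩, fun k => ?_⟩
      simp only [hc]
      rw [coeff_cst_mul _ (der_X d)]
      exact seriesHasLinear_halfShift d _
    have e2 := hU.mul hσ
    -- Moving $L$ through $L^m\Lambda^{-m}$ turns it into $\Lambda^mL\Lambda^{-m}$, whose linear
    -- coefficient is $\varepsilon\,\partial L$; comparing linear coefficients gives the commutator.
    have e : ∀ m : ℕ, L * (L ^ m * single (-1) 1 ^ m) =
        L ^ m * single (-1) 1 ^ m * (single 1 1 ^ m * L * single (-1) 1 ^ m) := fun m => by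
      rw [mul_assoc (L ^ m), mul_assoc (single 1 1 ^ m), ← mul_assoc (single (-1) 1 ^ m),
        pow_mul_pow_eq_one m hZΛ, one_mul, ← mul_assoc, ← mul_assoc, (Commute.refl L).pow_right m]
    simp only [e] at e1
    have := e1.unique e2
    simpa using this
  -- The factor $\Lambda^mL^{-m}$ inverts $L^m\Lambda^{-m}$, making the trace exactly proportional
  -- to $m$. It does not affect the linear coefficient, because the varied factor vanishes at $m=0$.
  · have e1 := (hU.variation δ κ).mul (hV.mul (OpHasLinear.const (L ^ n)))
    have := e1.res_eq (x := res (variation δ κ L * (Y * L ^ n)) - κ • res (L ^ n)) fun m => ?_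
    · simpa [variation_one] using this
    · have hcomm : Commute L Y := hLY.trans hYL.symm
      have hZm : variation δ κ ((single (-1) 1 : DiffOp d) ^ m) =
          cst (algebraMap ℚ R⟦X⟧ (-(m * κ))) * single (-1) 1 ^ m := by
        rw [single_one_pow, variation_single_one]
        congr 3
        push_cast
        ring
      have hcanc : ∀ A : DiffOp d, single (-1) 1 ^ m * (single 1 1 ^ m * A) = A := fun A => by
        rw [← mul_assoc, pow_mul_pow_eq_one m hZΛ, one_mul]
      have hfirst : res (variation δ κ (L ^ m) * (Y ^ m * L ^ n)) =
          (m : ℚ) • res (variation δ κ L * (Y * L ^ n)) := by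
        cases m with
        | zero => simp [variation_one]
        | succ k =>
          rw [res_variation_pow_mul hδ κ
            ((hcomm.pow_right _).mul_right ((Commute.refl L).pow_right n)), pow_succ Y,
            mul_assoc (Y ^ k), ← mul_assoc (L ^ k), pow_mul_pow_eq_one k hLY, one_mul]
          push_cast
          rfl
      rw [variation_mul hδ, hZm, add_mul, map_add, mul_assoc, mul_assoc (single 1 1 ^ m), hcanc,
        hfirst, ← mul_assoc (L ^ m), ← cst_comm (der_algebraMap d _), mul_assoc, mul_assoc,
        hcanc, ← mul_assoc (L ^ m), pow_mul_pow_eq_one m hLY, one_mul,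
        res_cst_algebraMap_mul]
      module

/-! ### Traces of variations -/

theorem res_variation_zero (κ : ℚ) (A : DiffOp d) :
    res (variation (0 : Derivation ℚ R R) κ A) = 0 := by
  rw [res_apply, coeff_variation]
  have : der (0 : Derivation ℚ R R) (A.coeff 0) = 0 := by
    ext n
    simp [der]
  simp [this]

theorem variation_single (δ : Derivation ℚ R R) (κ : ℚ) (j : ℤ) (a : R⟦X⟧) :
    variation δ κ (single j a : DiffOp d) = single j (der δ a + (κ * j) • a) := by
  ext1
  funext k
  rw [coeff_variation, coeff_single, coeff_single]
  split_ifs with h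
  · rw [h]
  · rw [der_zero, smul_zero, add_zero]

theorem res_single_mul (j : ℤ) (a : R⟦X⟧) (A : DiffOp d) :
    res (single j a * A) = (exact d).mkQ (a * A.coeff (-j)) := by
  rw [res_apply, coeff_single_mul, zero_sub, neg_neg, ← map_mul, mkQ_halfShift]

/-- For $\delta=0$, $\kappa=1$ and $A=L^n$ this is $p_{-1}(n)-q\,p_1(n)$, as in the constants of
motion; for $\kappa=0$ it is the integrand of the variation of $H_n$. -/
theorem res_variation_opK_mul (δ : Derivation ℚ R R) (κ : ℚ) (v q : R⟦X⟧) (A : DiffOp d) :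
    res (variation δ κ (opK v q) * A) = (exact d).mkQ (κ • A.coeff (-1) + der δ v * A.coeff 0 +
      (der δ q - κ • q) * A.coeff 1) := by
  rw [opK, map_add, map_add, variation_single, variation_single, variation_single, add_mul,
    add_mul, map_add, map_add, res_single_mul, res_single_mul, res_single_mul, der_one, map_add,
    map_add]
  simp [sub_eq_add_neg]

theorem variation_inverse {δ : Derivation ℚ R R} (hδ : ∀ x, δ (d x) = d (δ x)) (κ : ℚ)
    {L Y : DiffOp d} (hLY : L * Y = 1) (hYL : Y * L = 1) :
    variation δ κ Y = -(Y * variation δ κ L * Y) := by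
  have e := congrArg (variation δ κ) hLY
  rw [variation_mul hδ, variation_one] at e
  have e2 := congrArg (Y * ·) e
  simp only [mul_add, ← mul_assoc, hYL, one_mul, mul_zero] at e2
  exact eq_neg_of_add_eq_zero_right e2

theorem res_variation_inverse_pow {δ : Derivation ℚ R R} (hδ : ∀ x, δ (d x) = d (δ x)) (κ : ℚ)
    {L Y : DiffOp d} (hLY : L * Y = 1) (hYL : Y * L = 1) (k n : ℕ) :
    res (variation δ κ (Y ^ (k + 1)) * L ^ n) =
      -((k + 1 : ℚ) • res (variation δ κ L * (Y ^ (k + 2) * L ^ n))) := by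
  have hcomm : Commute Y L := hYL.trans hLY.symm
  have e : Y * (Y ^ k * (L ^ n * Y)) = Y ^ (k + 2) * L ^ n := by
    rw [← (hcomm.pow_right n).eq, pow_succ, pow_succ']
    noncomm_ring
  rw [res_variation_pow_mul hδ κ (hcomm.pow_right n), variation_inverse hδ κ hLY hYL, neg_mul,
    map_neg, smul_neg, mul_assoc, mul_assoc, res_mul_comm, mul_assoc, mul_assoc, mul_assoc, e]

/-- The top coefficients of $LT$ and $TL$ are $\mathsf E^{1/2}t$ and $\mathsf E^{-1/2}t$. Their
difference is $\varepsilon\partial t$ up to an invertible operator. -/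
theorem der_coeff_eq_zero_of_commute {L T : DiffOp d} (h1 : L.coeff 1 = 1)
    (h : ∀ k, 1 < k → L.coeff k = 0) {r : ℤ} (hT : ∀ k, r < k → T.coeff k = 0)
    (hc : L * T = T * L) : der d (T.coeff r) = 0 := by
  have e1 := coeff_mul_top h hT
  have e2 := coeff_mul_top hT h
  rw [h1, map_one, one_mul, hc, add_comm] at e1
  rw [h1, map_one, mul_one, e1, halfShift_eq_op, halfShift_eq_op] at e2
  have hX : expSeries (1 / 2) = PowerSeries.X * sinhcSeries + expSeries (-1 / 2) := by
    rw [X_mul_sinhcSeries, sub_add_cancel]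
  push_cast at e2
  rw [hX, op_add, add_eq_right] at e2
  have e3 := congrArg (op d sinhcSeries⁻¹) e2
  rw [map_zero, ← op_mul, mul_left_comm, mul_comm sinhcSeries⁻¹, sinhcSeries_mul_inv, mul_one,
    op_X] at e3
  ext n
  rw [← PowerSeries.coeff_succ_X_mul, e3, map_zero, map_zero]

/-! ### The Lax operator as a function of its logarithm -/

/-- The difference between `L - K - τ ℓ` and the first terms of its expansion in powers of
`Y = L⁻¹`. -/
def laxTail (v q τ : R⟦X⟧) (z : ℕ → R⟦X⟧) (L Y ℓ : DiffOp d) (N : ℕ) : DiffOp d :=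
  L - opK v q - cst τ * ℓ -
    ∑ k ∈ Finset.range N, cst ((1 / (k + 1 : ℚ)) • z (k + 1)) * Y ^ (k + 1)

section Tail

variable {v q τ : R⟦X⟧} {z : ℕ → R⟦X⟧} {L Y ℓ : DiffOp d} (hL : IsLax v q τ z L)
  (hτ : der d τ = 0) (hz : ∀ n, der d (z n) = 0)
  (hLY : L * Y = 1) (hYL : Y * L = 1) (hY1 : Y.coeff (-1) = 1)
  (hY : ∀ k, -1 < k → Y.coeff k = 0) (hℓ : ∀ k, -1 < k → ℓ.coeff k = 0)
  (hLℓ : L * ℓ = ℓ * L + cst PowerSeries.X * derOp L)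
  (hres : ∀ (δ : Derivation ℚ R R) (_ : ∀ x, δ (d x) = d (δ x)) (κ : ℚ) (n : ℕ),
    res (variation δ κ ℓ * L ^ n) = res (variation δ κ L * (Y * L ^ n)) - κ • res (L ^ n))

include hz in
theorem der_smul_const (c : ℚ) (n : ℕ) : der d (c • z n) = 0 := by
  rw [der_smul, hz, smul_zero]

include hL hτ hz hLY hYL hLℓ in
-- The constraint on $[K,L]$ cancels $\tau[L,\ell]=\varepsilon\tau\,\partial L$, and powers of
-- $L^{-1}$ with constant coefficients commute with $L$.
theorem laxTail_commute (N : ℕ) : L * laxTail v q τ z L Y ℓ N = laxTail v q τ z L Y ℓ N * L := by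
  have hcomm : Commute L Y := hLY.trans hYL.symm
  have hK : opK v q * L - L * opK v q = cst τ * (cst PowerSeries.X * derOp L) := by
    ext1
    funext k
    rw [hL.constraint, coeff_cst_mul _ hτ, coeff_cst_mul _ (der_X d)]
    change _ * (τ * der d (L.coeff k)) = τ * (_ * der d (L.coeff k))
    ring
  have hsum : ∀ k ∈ Finset.range N,
      Commute L (cst ((1 / (k + 1 : ℚ)) • z (k + 1)) * Y ^ (k + 1)) := fun k _ =>
    Commute.mul_right (cst_comm (der_smul_const hz _ _) L).symm (hcomm.pow_right _)
  have hs := (Commute.sum_right _ _ L hsum).eq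
  rw [laxTail, mul_sub, sub_mul, hs, mul_sub, sub_mul, mul_sub, sub_mul, ← mul_assoc L (cst τ),
    ← cst_comm hτ L, mul_assoc, hLℓ, mul_add, ← hK, mul_assoc]
  abel

theorem laxTail_succ (N : ℕ) : laxTail v q τ z L Y ℓ (N + 1) = laxTail v q τ z L Y ℓ N -
    cst ((1 / (N + 1 : ℚ)) • z (N + 1)) * Y ^ (N + 1) := by
  rw [laxTail, Finset.sum_range_succ, ← sub_sub, ← laxTail]

include hτ hz hLY hYL hres in
-- Varying $L^{-(k+1)}$ under the trace produces the factor $-(k+1)$, which cancels the denominator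
-- of the coefficient $z_{k+1}/(k+1)$.
theorem res_variation_laxTail {δ : Derivation ℚ R R} (hδ : ∀ x, δ (d x) = d (δ x)) (κ : ℚ)
    (hδτ : der δ τ = 0) (hδz : ∀ n, der δ (z n) = 0) (N n : ℕ) :
    res (variation δ κ (laxTail v q τ z L Y ℓ N) * L ^ n) =
      res (variation δ κ L * L ^ n) - res (variation δ κ (opK v q) * L ^ n)
        - (res (cst τ * (variation δ κ L * (Y * L ^ n))) - κ • res (cst τ * L ^ n))
        + ∑ k ∈ Finset.range N,
          res (cst (z (k + 1)) * (variation δ κ L * (Y ^ (k + 2) * L ^ n))) := by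
  have h1 : res (variation δ κ (cst τ * ℓ) * L ^ n) =
      res (cst τ * (variation δ κ L * (Y * L ^ n))) - κ • res (cst τ * L ^ n) := by
    rw [variation_cst_mul hτ hδτ, mul_assoc, ← res_cst_algebraMap_mul, ← map_sub,
      ← mul_assoc _ (cst τ), cst_comm (der_algebraMap d κ), mul_assoc, ← mul_sub]
    refine res_cst_mul_congr hτ ?_
    rw [hres δ hδ, map_sub, res_cst_algebraMap_mul]
  have h2 : ∀ k : ℕ, res (variation δ κ (cst ((1 / (k + 1 : ℚ)) • z (k + 1)) * Y ^ (k + 1)) * L ^ n) =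
      -res (cst (z (k + 1)) * (variation δ κ L * (Y ^ (k + 2) * L ^ n))) := fun k => by
    have hδ' : der δ ((1 / (k + 1 : ℚ)) • z (k + 1)) = 0 := by rw [der_smul, hδz, smul_zero]
    have e := res_variation_inverse_pow hδ κ hLY hYL k n
    rw [← neg_smul] at e
    rw [variation_cst_mul (der_smul_const hz _ _) hδ', mul_assoc, res_cst_smul_mul _ (hz _),
      res_cst_mul_of_eq_smul (hz _) e, smul_smul, one_div, mul_neg,
      inv_mul_cancel₀ (by positivity), neg_one_smul]
  simp only [laxTail, map_sub, map_sum, sub_mul, Finset.sum_mul, h1, h2, Finset.sum_neg_distrib]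
  abel

include hL in
theorem opK_sub_order (k : ℤ) (hk : -1 < k) : (L - opK v q).coeff k = 0 := by
  rcases lt_trichotomy k 1 with h' | rfl | h'
  · obtain rfl : k = 0 := by omega
    simp [opK, coeff_single, hL.coeff_zero]
  · simp [opK, coeff_single, hL.coeff_one]
  · have a : k ≠ 1 := by omega
    have b : k ≠ 0 := by omega
    have c : k ≠ -1 := by omega
    simp [opK, coeff_single, hL.coeff_gt k h', a, b, c]

include hL hτ hz hLY hYL hY1 hY hℓ hLℓ hres in
-- By induction the leading coefficient $t$ of the tail is constant, as the tail commutes with $L$.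
-- A constant that is a total derivative is zero by `hker`, so $t=z_{N+1}/(N+1)$ need only be shown
-- modulo total derivatives. This follows by pairing the graded variation of the tail with
-- $L^{N+1}$.
theorem laxTail_order (hker : ∀ f : R⟦X⟧, der d f = 0 → f ∈ exact d → f = 0) (N : ℕ) :
    ∀ k, -(N + 1 : ℤ) < k → (laxTail v q τ z L Y ℓ N).coeff k = 0 := by
  have h1 := hL.coeff_one
  have h := hL.coeff_gt
  induction N with
  | zero =>
    intro k hk
    have hk : -1 < k := by simpa using hk
    rw [laxTail, Finset.sum_range_zero, sub_zero, coeff_sub, opK_sub_order hL k hk,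
      coeff_cst_mul _ hτ, hℓ k hk, mul_zero, sub_zero]
  | succ N ih =>
    set T := laxTail v q τ z L Y ℓ N with hT
    set r : ℤ := -(N + 1 : ℤ) with hr
    have hYm := monic_pow hY1 hY (N + 1)
    have hsucc : ∀ k, (laxTail v q τ z L Y ℓ (N + 1)).coeff k =
        T.coeff k - (1 / (N + 1 : ℚ)) • z (N + 1) * (Y ^ (N + 1)).coeff k := fun k => by
      rw [laxTail_succ, coeff_sub, coeff_cst_mul _ (der_smul_const hz _ _)]
    intro k hk
    push_cast at hk hYm
    rcases (show k = r ∨ r < k by omega) with rfl | hk'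
    swap
    · rw [hsucc, ih k hk', hYm.2 k (by omega), mul_zero, sub_zero]
    rw [hsucc, show r = (N + 1 : ℤ) * -1 by omega, hYm.1, mul_one,
      show (N + 1 : ℤ) * -1 = r by omega]
    have hd := der_coeff_eq_zero_of_commute h1 h ih
      (laxTail_commute hL hτ hz hLY hYL hLℓ N)
    refine hker _ ?_ ?_
    · rw [sub_eq_add_neg, der_add, hd, ← neg_smul, der_smul_const hz, add_zero]
    have hθ : ∀ x : R, (0 : Derivation ℚ R R) (d x) = d ((0 : Derivation ℚ R R) x) := fun x => by
      simp
    have hθ0 : ∀ f : R⟦X⟧, der (0 : Derivation ℚ R R) f = 0 := fun f => by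
      ext n
      simp [der]
    -- The grading derivation multiplies the coefficient of $\Lambda^0$ by $0$, so its trace
    -- vanishes on every power of $L$.
    have hLpow : ∀ j, res (variation 0 1 L * L ^ j) = 0 := fun j => by
      have := res_variation_pow_mul hθ 1 (Commute.one_right L) j
      rw [mul_one, res_variation_zero, mul_one] at this
      exact (smul_eq_zero.1 this.symm).resolve_left (by positivity)
    have e := res_variation_laxTail (v := v) (q := q) hτ hz hLY hYL hres hθ 1 (hθ0 _)
      (fun _ => hθ0 _) N (N + 1)
    have hYL' : ∀ k, k < N + 1 → res (variation 0 1 L * (Y ^ (k + 1) * L ^ (N + 1))) = 0 :=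
      fun k hk => by rw [pow_mul_pow_of_le hYL (by omega), hLpow]
    have hY0 := hYL' 0 (by omega)
    rw [zero_add, pow_one] at hY0
    rw [Finset.sum_eq_zero fun k hk => res_cst_mul_eq_zero (hz _)
      (hYL' (k + 1) (by rw [Finset.mem_range] at hk; omega)), hLpow,
      res_cst_mul_eq_zero hτ hY0, res_variation_opK_mul, hθ0, hθ0, one_smul, one_smul, one_smul,
      zero_mul, add_zero, zero_sub, zero_sub, zero_sub, sub_neg_eq_add, add_zero] at e
    -- Modulo total derivatives $\mathsf P$ is the identity, so the term with $\tau$ completes the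
    -- constant of motion.
    have hP : (exact d).mkQ (τ * (L ^ (N + 1)).coeff 0) =
        (exact d).mkQ (τ * opP d ((L ^ (N + 1)).coeff 0)) := by
      refine ((Submodule.Quotient.eq _).2 ?_).symm
      rw [← mul_sub]
      exact const_mul_mem_exact hτ (opP_sub_mem_exact _)
    -- The tail has order at most $-(N+1)$, so only the product of leading terms reaches
    -- $\Lambda^0$; the grading supplies the factor $-(N+1)$.
    have e2 := coeff_mul_top (variation_order (δ := 0) (κ := 1) ih) (pow_monic h1 h (N + 1)).2
    rw [(pow_monic h1 h (N + 1)).1, map_one, mul_one, coeff_variation, hθ0, zero_add, one_mul,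
      show r + ((N + 1 : ℕ) : ℤ) = 0 by push_cast; omega] at e2
    rw [res_apply, e2, mkQ_halfShift, res_apply, coeff_cst_mul _ hτ, hP, ← map_neg, ← map_add,
      map_smul] at e
    have hzN : -((L ^ (N + 1)).coeff (-1) + -q * (L ^ (N + 1)).coeff 1) +
        τ * opP d ((L ^ (N + 1)).coeff 0) = -z (N + 1) := by
      rw [← hL.constants (N + 1) (Nat.succ_pos N)]
      ring
    rw [hzN] at e
    rw [← Submodule.ker_mkQ (exact d), LinearMap.mem_ker, map_sub, map_smul, ← neg_neg (z (N + 1)),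
      map_neg, ← e, hr, smul_neg, smul_smul]
    push_cast
    rw [← neg_smul, ← mul_neg, neg_neg, one_div_mul_cancel (by positivity), one_smul, sub_self]

include hL hτ hz hLY hYL hY1 hY hℓ hLℓ hres in
-- After $n$ terms the tail has order at most $-(n+1)$, so against $L^n$ it has zero trace and the
-- infinite expansion of $L$ is never needed.
theorem res_variation_opK (hker : ∀ f : R⟦X⟧, der d f = 0 → f ∈ exact d → f = 0)
    {δ : Derivation ℚ R R} (hδ : ∀ x, δ (d x) = d (δ x))
    (hδτ : der δ τ = 0) (hδz : ∀ n, der δ (z n) = 0) (n : ℕ) :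
    res (variation δ 0 (opK v q) * L ^ n) =
      res (variation δ 0 L * L ^ n) - res (cst τ * (variation δ 0 L * (Y * L ^ n)))
        + ∑ k ∈ Finset.range n,
          res (cst (z (k + 1)) * (variation δ 0 L * (Y ^ (k + 2) * L ^ n))) := by
  have e := res_variation_laxTail (v := v) (q := q) hτ hz hLY hYL hres hδ 0 hδτ hδz n n
  rw [res_eq_zero_of_order (variation_order (laxTail_order hL hτ hz hLY hYL hY1 hY hℓ hLℓ hres
    hker n)) (pow_monic hL.coeff_one hL.coeff_gt n).2 (by omega), zero_smul, sub_zero] at e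
  refine sub_eq_zero.1 (neg_eq_zero.1 (Eq.trans ?_ e.symm))
  abel

end Tail

/-- The density `p₀(n+1) / (n+1)`. -/
def powDensity (L : DiffOp d) (n : ℕ) : R⟦X⟧ := (1 / (n + 1 : ℚ)) • (L ^ (n + 1)).coeff 0

theorem res_variation_mul_pow {δ : Derivation ℚ R R} (hδ : ∀ x, δ (d x) = d (δ x))
    (L : DiffOp d) (n : ℕ) :
    res (variation δ 0 L * L ^ n) = (exact d).mkQ (der δ (powDensity L n)) := by
  have e := res_variation_pow_mul hδ 0 (Commute.one_right L) n
  rw [mul_one, mul_one, res_apply, coeff_variation, zero_mul, zero_smul, add_zero] at e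
  rw [powDensity, der_smul, map_smul, e, smul_smul, one_div_mul_cancel (by positivity), one_smul]

/-- The density of the Hamiltonian `h_n - τ h_{n-1} + ∑_{k=1}^{n-1} z_k h_{n-k-1}`. -/
def hamDensity (τ : R⟦X⟧) (z : ℕ → R⟦X⟧) (L : DiffOp d) (n : ℕ) : R⟦X⟧ :=
  powDensity L n - τ * (if n = 0 then 0 else powDensity L (n - 1)) +
    ∑ k ∈ Finset.Icc 1 (n - 1), z k * powDensity L (n - k - 1)

/-- Each $\mathrm{Res}(\delta L\,L^m)$ with $m\ge0$ is the variation of $h_m$, so the logarithmic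
Lax equation paired with $L^n$ reads off the combination defining $H_n$. -/
theorem der_hamDensity {v q τ : R⟦X⟧} {z : ℕ → R⟦X⟧} {L : DiffOp d} (hL : IsLax v q τ z L)
    (hτ : der d τ = 0) (hz : ∀ n, der d (z n) = 0)
    (hker : ∀ f : R⟦X⟧, der d f = 0 → f ∈ exact d → f = 0)
    {δ : Derivation ℚ R R} (hδ : ∀ x, δ (d x) = d (δ x))
    (hδτ : der δ τ = 0) (hδz : ∀ n, der δ (z n) = 0) (n : ℕ) :
    (exact d).mkQ (der δ (hamDensity τ z L n)) =
      (exact d).mkQ (der δ v * (L ^ n).coeff 0 + der δ q * (L ^ n).coeff 1) := by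
  obtain ⟨Y, hLY, hYL, hY1, hY⟩ := exists_inverse hL.coeff_one hL.coeff_gt
  obtain ⟨ℓ, hℓ, hLℓ, hres⟩ := exists_log hLY hYL hL.coeff_one hL.coeff_gt hY1 hY
  have e := res_variation_opK hL hτ hz hLY hYL hY1 hY hℓ hLℓ hres hker hδ hδτ hδz n
  rw [res_variation_opK_mul, zero_smul, zero_smul, zero_add, sub_zero] at e
  rw [e]
  have hcst : ∀ {c : R⟦X⟧} (_ : der d c = 0) (_ : der δ c = 0) (m : ℕ),
      res (cst c * (variation δ 0 L * L ^ m)) =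
        (exact d).mkQ (der δ (c * powDensity L m)) := fun {c} hc hc' m => by
    rw [der_mul, hc', zero_mul, zero_add]
    have := res_cst_mul_congr hc (A := variation δ 0 L * L ^ m)
      (B := cst (der δ (powDensity L m))) (by
        rw [res_variation_mul_pow hδ, res_apply, cst, coeff_single, if_pos rfl])
    rw [this, res_apply, coeff_cst_mul _ hc, cst, coeff_single, if_pos rfl]
  -- The leading coefficient of $L$ is $1$, so $\delta L$ has order at most $0$ and $\delta
  -- L\,L^{-1}$ has negative order. This justifies $h_{-1}=0$ and removes the term with $z_n$.
  have hY0 : res (variation δ 0 L * Y) = 0 := by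
    refine res_eq_zero_of_order (N := 0) (fun k hk => ?_) hY (by omega)
    rw [coeff_variation, zero_mul, zero_smul, add_zero]
    rcases (show k = 1 ∨ 1 < k by omega) with rfl | hk'
    · rw [hL.coeff_one, der_one]
    · rw [hL.coeff_gt k hk', der_zero]
  have hsub : ∀ f g : R⟦X⟧, der δ (f - g) = der δ f - der δ g := map_sub (derLin δ)
  rw [hamDensity, der_add, hsub, der_sum, map_add, map_sub, map_sum, res_variation_mul_pow hδ]
  congr 1
  · congr 1
    split_ifs with hn
    · rw [hn, pow_zero, mul_one, res_cst_mul_eq_zero hτ hY0, mul_zero, der_zero, map_zero]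
    · rw [← hcst hτ hδτ]
      have := pow_mul_pow_of_le hYL (show 1 ≤ n by omega)
      rw [pow_one] at this
      rw [this]
  · cases n with
    | zero => simp
    | succ n =>
      rw [Finset.sum_range_succ]
      have hlast : Y ^ (n + 2) * L ^ (n + 1) = Y := by
        rw [pow_succ', mul_assoc, pow_mul_pow_eq_one _ hYL, mul_one]
      rw [hlast, res_cst_mul_eq_zero (hz _) hY0, add_zero, Nat.add_sub_cancel,
        show Finset.Icc 1 n = Finset.Ico 1 (n + 1) by ext; simp,
        Finset.sum_Ico_eq_sum_range, Nat.add_sub_cancel]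
      refine Finset.sum_congr rfl fun k hk => ?_
      rw [Finset.mem_range] at hk
      rw [pow_mul_pow_of_le hYL (by omega), hcst (hz _) (hδz _), add_comm 1 k]
      congr 5

end LaxVariation

end EqToda

namespace EqToda

/-! ### Integration by parts and nondegeneracy on jets -/

noncomputable section

/-! ### Adjoints -/

section Adjoint

variable {R : Type*} [CommRing R] [Algebra ℚ R] {d : Derivation ℚ R R}

theorem mem_exact_iff_coeff {f : R⟦X⟧} :
    f ∈ exact d ↔ ∀ n, PowerSeries.coeff n f ∈ LinearMap.range d.toLinearMap := by
  constructor
  · rintro ⟨g, rfl⟩ n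
    exact ⟨PowerSeries.coeff n g, by simp [derLin, der]⟩
  · intro h
    choose g hg using h
    refine ⟨PowerSeries.mk g, ?_⟩
    ext n
    rw [← hg n]
    simp [derLin, der]

theorem iter_mul_sub_mem_range (n : ℕ) (x y : R) :
    d^[n] x * y - x * ((-1 : ℚ) ^ n • d^[n] y) ∈ LinearMap.range d.toLinearMap := by
  induction n generalizing x with
  | zero => simp
  | succ n ih =>
    have h1 := ih (d x)
    have h2 : d (x * ((-1 : ℚ) ^ n • d^[n] y)) ∈ LinearMap.range d.toLinearMap := ⟨_, rfl⟩
    convert add_mem h1 h2 using 1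
    rw [Derivation.leibniz, map_rat_smul, Function.iterate_succ_apply, pow_succ,
      ← Function.iterate_succ_apply' d, mul_neg_one, neg_smul, smul_eq_mul, smul_eq_mul]
    ring

theorem op_mul_sub_mem_exact (φ : ℚ⟦X⟧) (f g : R⟦X⟧) :
    op d φ f * g - f * op d (PowerSeries.rescale (-1) φ) g ∈ exact d := by
  rw [mem_exact_iff_coeff]
  intro n
  have h1 : PowerSeries.coeff n (op d φ f * g) = ∑ p ∈ Finset.HasAntidiagonal.antidiagonal n,
      ∑ r ∈ Finset.HasAntidiagonal.antidiagonal p.1, PowerSeries.coeff r.1 φ •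
        (d^[r.1] (PowerSeries.coeff r.2 f) * PowerSeries.coeff p.2 g) := by
    simp only [PowerSeries.coeff_mul, coeff_op, Finset.sum_mul, smul_mul_assoc]
  have h2 : PowerSeries.coeff n (f * op d (PowerSeries.rescale (-1) φ) g) =
      ∑ p ∈ Finset.HasAntidiagonal.antidiagonal n,
      ∑ r ∈ Finset.HasAntidiagonal.antidiagonal p.1, PowerSeries.coeff r.1 φ •
        (PowerSeries.coeff r.2 f * ((-1 : ℚ) ^ r.1 • d^[r.1] (PowerSeries.coeff p.2 g))) := by
    simp only [PowerSeries.coeff_mul, coeff_op, Finset.mul_sum, PowerSeries.coeff_rescale]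
    rw [Finset.sum_sigma', Finset.sum_sigma']
    refine Finset.sum_nbij' (fun x => ⟨(x.2.1 + x.1.1, x.2.2), (x.2.1, x.1.1)⟩)
      (fun x => ⟨(x.2.2, x.2.1 + x.1.2), (x.2.1, x.1.2)⟩) ?_ ?_ ?_ ?_ ?_
    · rintro ⟨⟨a, b⟩, ⟨i, j⟩⟩ h
      simp at h ⊢
      omega
    · rintro ⟨⟨a, b⟩, ⟨i, j⟩⟩ h
      simp at h ⊢
      omega
    · rintro ⟨⟨a, b⟩, ⟨i, j⟩⟩ h
      simp at h ⊢
      omega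
    · rintro ⟨⟨a, b⟩, ⟨i, j⟩⟩ h
      simp at h ⊢
      omega
    · rintro ⟨⟨a, b⟩, ⟨i, j⟩⟩ h
      simp only [mul_smul_comm, smul_smul]
      rw [mul_comm]
  rw [map_sub, h1, h2, ← Finset.sum_sub_distrib]
  refine Submodule.sum_mem _ fun p _ => ?_
  rw [← Finset.sum_sub_distrib]
  refine Submodule.sum_mem _ fun r _ => ?_
  rw [← smul_sub]
  exact Submodule.smul_mem _ _ (iter_mul_sub_mem_range _ _ _)

/-- The adjoint of $\varphi(\varepsilon\partial)$ is $\varphi(-\varepsilon\partial)$, and the series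
of $\mathsf P$ is even. -/
theorem opP_mul_sub_mem_exact (f g : R⟦X⟧) : opP d f * g - f * opP d g ∈ exact d := by
  have h1 : PowerSeries.rescale (-1 : ℚ) sinhcSeries = sinhcSeries := by
    ext n
    rw [PowerSeries.coeff_rescale, sinhcSeries, PowerSeries.coeff_mk]
    split_ifs with h
    · rw [h.neg_one_pow, one_mul]
    · rw [mul_zero]
  have h2 : PowerSeries.rescale (-1 : ℚ) sinhcSeries⁻¹ = sinhcSeries⁻¹ := by
    have h3 := congrArg (PowerSeries.rescale (-1 : ℚ)) sinhcSeries_mul_inv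
    rw [map_mul, h1, map_one] at h3
    have h4 := sinhcSeries_mul_inv
    rw [mul_comm] at h4
    exact (left_inv_eq_right_inv h4 h3).symm
  have := op_mul_sub_mem_exact (d := d) sinhcSeries⁻¹ f g
  rwa [h2] at this

end Adjoint

/-! ### Jets -/

open MvPolynomial (X)

theorem prolong_apply_succ (g : ℕ →₀ Jets) (k : ℕ) :
    prolong g (k + 1) = jetDer (g (k + 1)) + g k := by
  have hm : Finsupp.mapDomain Nat.succ g (k + 1) = g k :=
    Finsupp.mapDomain_apply Nat.succ_injective g k
  simp [prolong, hm]

/-- The last nonzero entry of $g$ reappears unchanged one place further on. -/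
theorem eq_zero_of_prolong_eq_zero {g : ℕ →₀ Jets} (h : prolong g = 0) : g = 0 := by
  by_contra hg
  have hs := Finsupp.support_nonempty_iff.2 hg
  have h1 := prolong_apply_succ g (g.support.max' hs)
  have h2 : g (g.support.max' hs + 1) = 0 := by
    by_contra h3
    have := g.support.le_max' _ (Finsupp.mem_support_iff.2 h3)
    omega
  rw [h, h2, map_zero, Finsupp.zero_apply, zero_add] at h1
  exact Finsupp.mem_support_iff.1 (g.support.max'_mem hs) h1.symm

theorem jetDer_eq_grad (x : Jets) : jetDer x =
    Finsupp.linearCombination Jets (fun k => (X (.v (k + 1)) : Jets)) (gradV x) +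
    Finsupp.linearCombination Jets (fun k => (X (.u (k + 1)) : Jets)) (gradU x) := by
  have : jetDer =
      (Finsupp.linearCombination Jets fun k => (X (.v (k + 1)) : Jets)).compDer gradV +
      (Finsupp.linearCombination Jets fun k => (X (.u (k + 1)) : Jets)).compDer gradU := by
    refine MvPolynomial.derivation_ext fun i => ?_
    cases i <;> simp [jetDer, gradV, gradU, MvPolynomial.mkDerivation_X]
  exact congrArg (fun D => D x) this

/-- The gradients of $\partial^2x$ are the twice prolonged gradients of $x$, and prolongation is
injective; an element with zero gradients has zero total derivative. This supplies the hypothesis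
`hker`. -/
theorem jetDer_eq_zero_of_jetDer_jetDer {x : Jets} (h : jetDer (jetDer x) = 0) :
    jetDer x = 0 := by
  have hV : gradV x = 0 := by
    refine eq_zero_of_prolong_eq_zero (eq_zero_of_prolong_eq_zero ?_)
    rw [← gradV_jetDer, ← gradV_jetDer, h, map_zero]
  have hU : gradU x = 0 := by
    refine eq_zero_of_prolong_eq_zero (eq_zero_of_prolong_eq_zero ?_)
    rw [← gradU_jetDer, ← gradU_jetDer, h, map_zero]
  rw [jetDer_eq_grad, hV, hU, map_zero, map_zero, add_zero]

theorem eq_zero_of_der_eq_zero_of_mem_exact (f : TodaAlg) (h : der jetDerRat f = 0)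
    (hf : f ∈ exact jetDerRat) : f = 0 := by
  obtain ⟨g, rfl⟩ := hf
  ext1 n
  have := congrArg (PowerSeries.coeff n) h
  simp only [der, derLin, LinearMap.coe_mk, AddHom.coe_mk, PowerSeries.coeff_mk, map_zero] at this ⊢
  exact jetDer_eq_zero_of_jetDer_jetDer this

/-! ### Nondegeneracy of the pairing by integration -/

/-- Each application of $\partial$ raises the differential order in $v$ by one and keeps the top
partial derivative. -/
theorem gradV_iter {x : Jets} {n : ℕ} (h : ∀ k, n < k → gradV x k = 0) (j : ℕ) :
    gradV (jetDer^[j] x) (n + j) = gradV x n ∧ ∀ k, n + j < k → gradV (jetDer^[j] x) k = 0 := by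
  induction j with
  | zero => exact ⟨rfl, h⟩
  | succ j ih =>
    simp only [Function.iterate_succ_apply', gradV_jetDer]
    refine ⟨?_, fun k hk => ?_⟩
    · rw [← add_assoc, prolong_apply_succ, ih.2 _ (by omega), ih.1, map_zero, zero_add]
    · obtain ⟨k, rfl⟩ := Nat.exists_eq_add_of_lt hk
      rw [prolong_apply_succ, ih.2 _ (by omega), ih.2 _ (by omega), map_zero, add_zero]

theorem byParts_single (k : ℕ) (x : Jets) :
    byParts (Finsupp.single k x) = ((-1) ^ k : Constants) • jetDer^[k] x := by
  rw [byParts, Finsupp.lsum_single]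
  induction k with
  | zero => simp
  | succ k ih =>
    rw [pow_succ', Module.End.mul_apply, ih, Function.iterate_succ_apply', map_smul,
      LinearMap.neg_apply, pow_succ', neg_one_mul, neg_smul, smul_neg]
    rfl

theorem exists_gradV_bound (x : Jets) : ∃ n, ∀ k, n < k → gradV x k = 0 := by
  refine ⟨(gradV x).support.sup id, fun k hk => ?_⟩
  by_contra h
  have := Finset.le_sup (f := id) (Finsupp.mem_support_iff.2 h)
  simp at this
  omega

/-- Test with $g=w^2$, where $w=v^{(N)}$ has order beyond everything in $x$. The Euler operator
kills $w^2x$, yet its derivative in $v^{(2N)}$ is $\pm2x$; the jets form a domain, so $x=0$. -/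
theorem eq_zero_of_mul_mem_range {x : Jets} (h : ∀ g, ∃ y, jetDer y = g * x) : x = 0 := by
  choose b hb using exists_gradV_bound
  -- Large enough that neither $x$ nor any of its partial derivatives $\partial x/\partial v^{(k)}$
  -- involves $v^{(j)}$ with $j\ge N$.
  set N := b x + (gradV x).support.sup (fun k => b (gradV x k)) + 1 with hN
  have hx : ∀ k, N ≤ k → gradV x k = 0 := fun k hk => hb x k (by omega)
  have hxk : ∀ k ∈ (gradV x).support, ∀ j, N ≤ j → gradV (gradV x k) j = 0 := fun k hk j hj => by
    have : b (gradV x k) ≤ (gradV x).support.sup (fun k => b (gradV x k)) :=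
      Finset.le_sup (f := fun k => b (gradV x k)) hk
    exact hb _ j (by omega)
  set w : Jets := X (.v N) with hw
  have hgw : gradV w = Finsupp.single N 1 := MvPolynomial.mkDerivation_X _ _ _
  obtain ⟨y, hy⟩ := h (w * w)
  have e : byParts (gradV (w * w * x)) = 0 := by rw [← hy, gradV_jetDer, byParts_prolong]
  have e2 : gradV (w * w * x) = Finsupp.single N ((w + w) * x) +
      ∑ k ∈ (gradV x).support, Finsupp.single k (w * w * gradV x k) := by
    rw [Derivation.leibniz, Derivation.leibniz, hgw]
    conv_lhs => rw [← Finsupp.sum_single (gradV x), Finsupp.sum, Finset.smul_sum]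
    rw [add_comm, ← add_smul, smul_smul, Finsupp.smul_single, smul_eq_mul, mul_one]
    congr 1
    · congr 1
      ring
    · simp
  have hmul : ∀ a c k, gradV (a * c) k = a * gradV c k + c * gradV a k := fun a c k => by
    rw [Derivation.leibniz]
    rfl
  have hwk : ∀ k, N < k → gradV w k = 0 := fun k hk => by
    rw [hgw, Finsupp.single_apply, if_neg (by omega)]
  have hN1 : ∀ k, N < k → gradV ((w + w) * x) k = 0 := fun k hk => by
    rw [hmul, map_add, Finsupp.add_apply, hwk k hk, hx k hk.le, mul_zero, add_zero, mul_zero,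
      add_zero]
  have hN2 : ∀ j ∈ (gradV x).support, ∀ k, N < k → gradV (w * w * gradV x j) k = 0 := fun j hj k hk => by
    rw [hmul, hmul, hwk k hk, hxk j hj k hk.le, mul_zero, mul_zero, add_zero, mul_zero, add_zero]
  -- Only $(-\partial)^N(2wx)$ reaches order $2N$: the other terms are $(-\partial)^k$ with $k<N$ of
  -- expressions of order at most $N$.
  have e3 := congrArg (fun z => gradV z (N + N)) e
  simp only [e2, map_add, map_sum, byParts_single, Derivation.map_smul, Finsupp.add_apply,
    Finsupp.smul_apply, Finsupp.finsetSum_apply, map_zero, Finsupp.zero_apply] at e3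
  rw [(gradV_iter hN1 N).1, Finset.sum_eq_zero, add_zero] at e3
  · have h1 : gradV ((w + w) * x) N = 2 * x := by
      rw [hmul, hx N le_rfl, map_add gradV, Finsupp.add_apply, hgw, Finsupp.single_eq_same]
      ring
    rw [h1, smul_eq_zero] at e3
    have h2 := e3.resolve_left (pow_ne_zero _ (neg_ne_zero.2 one_ne_zero))
    exact (mul_eq_zero.1 h2).resolve_left two_ne_zero
  · intro k hk
    have hkN : k < N := by
      by_contra h
      exact Finsupp.mem_support_iff.1 hk (hx k (by omega))
    rw [(gradV_iter (hN2 k hk) k).2 _ (by omega), smul_zero]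

/-! ### The first variation -/

theorem iter_totalDer_mul_sub_mem_exact (k : ℕ) (a y : TodaAlg) :
    y * totalDer^[k] a - a * ((-1) ^ k * totalDer^[k] y) ∈ exact jetDerRat := by
  induction k generalizing y with
  | zero =>
    rw [pow_zero, one_mul]
    simp [mul_comm]
  | succ k ih =>
    have h1 := ih (totalDer y)
    have h2 : totalDer (y * totalDer^[k] a) ∈ exact jetDerRat := ⟨_, rfl⟩
    convert sub_mem h2 h1 using 1
    rw [totalDer_mul, Function.iterate_succ_apply', Function.iterate_succ_apply, pow_succ]
    ring

section Pullback

variable (φ : Jets →+* TodaAlg)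

/-- The map `(yₖ) ↦ ∑ₖ φ(yₖ) ∂ᵏa`. -/
def pairing (a : TodaAlg) : (ℕ →₀ Jets) →+ TodaAlg :=
  Finsupp.liftAddHom fun k => (AddMonoidHom.mulRight (totalDer^[k] a)).comp φ.toAddMonoidHom

variable {φ}

theorem pairing_single (a : TodaAlg) (k : ℕ) (y : Jets) :
    pairing φ a (Finsupp.single k y) = φ y * totalDer^[k] a := by
  simp [pairing]

theorem pairing_smul (a : TodaAlg) (x : Jets) (g : ℕ →₀ Jets) :
    pairing φ a (x • g) = φ x * pairing φ a g := by
  induction g using Finsupp.induction_linear with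
  | zero => simp
  | add g h hg hh => rw [smul_add, map_add, map_add, hg, hh, mul_add]
  | single k y => rw [Finsupp.smul_single, pairing_single, pairing_single, smul_eq_mul, map_mul,
      mul_assoc]

theorem map_iter_jetDer (hφ : ∀ x, φ (jetDer x) = totalDer (φ x)) (k : ℕ) (x : Jets) :
    φ (jetDer^[k] x) = totalDer^[k] (φ x) := by
  induction k with
  | zero => rfl
  | succ k ih => rw [Function.iterate_succ_apply', hφ, ih, Function.iterate_succ_apply']

theorem pairing_sub_mem_exact (hφ : ∀ x, φ (jetDer x) = totalDer (φ x)) (a : TodaAlg)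
    (g : ℕ →₀ Jets) : pairing φ a g - a * φ (byParts g) ∈ exact jetDerRat := by
  induction g using Finsupp.induction_linear with
  | zero => simp
  | add g h hg hh =>
    rw [map_add, map_add, map_add, mul_add, add_sub_add_comm]
    exact add_mem hg hh
  | single k y =>
    have h1 : φ (((-1) ^ k : Constants) • jetDer^[k] y) = (-1) ^ k * totalDer^[k] (φ y) := by
      rw [Algebra.smul_def, map_mul, map_iter_jetDer hφ, map_pow, map_neg, map_one, map_pow,
        map_neg, map_one]
    rw [pairing_single, byParts_single, h1]
    exact iter_totalDer_mul_sub_mem_exact k a (φ y)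

/-- The chain rule: a derivation along $\varphi$ is determined by its values on the generators,
where both sides agree. -/
theorem eq_pairing {D : Jets →+ TodaAlg} (hmul : ∀ x y, D (x * y) = φ x * D y + φ y * D x)
    (hC : ∀ c, D (MvPolynomial.C c) = 0) {a b : TodaAlg} (hq : D (X .q) = φ (X .q) * b)
    (hv : ∀ k, D (X (.v k)) = totalDer^[k] a) (hu : ∀ k, D (X (.u k)) = totalDer^[k] b)
    (x : Jets) : D x = pairing φ a (gradV x) + pairing φ b (gradU x) := by
  induction x using MvPolynomial.induction_on with
  | C c =>
    have h1 : gradV (MvPolynomial.C c) = 0 := gradV.map_algebraMap c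
    have h2 : gradU (MvPolynomial.C c) = 0 := gradU.map_algebraMap c
    rw [hC, h1, h2, map_zero, map_zero, add_zero]
  | add x y hx hy =>
    rw [map_add, hx, hy, map_add, map_add, map_add, map_add]
    ring
  | mul_X x i hx =>
    have hi : D (X i) = pairing φ a (gradV (X i)) + pairing φ b (gradU (X i)) := by
      cases i with
      | q => simp [hq, gradV, gradU, MvPolynomial.mkDerivation_X, pairing_single]
      | v k => simp [hv, gradV, gradU, MvPolynomial.mkDerivation_X, pairing_single]
      | u k => simp [hu, gradV, gradU, MvPolynomial.mkDerivation_X, pairing_single]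
    rw [hmul, hx, hi, Derivation.leibniz, Derivation.leibniz, map_add, map_add, pairing_smul,
      pairing_smul, pairing_smul, pairing_smul]
    ring

/-- The extension of an additive map from jets to series in `ε`. -/
def extendAdd (D : Jets →+ TodaAlg) (f : TodaAlg) : TodaAlg :=
  PowerSeries.mk fun n => ∑ p ∈ Finset.HasAntidiagonal.antidiagonal n,
    PowerSeries.coeff p.1 (D (PowerSeries.coeff p.2 f))

theorem mul_extendHom (a f : TodaAlg) (T : Jets → Jets) :
    a * extendHom φ (PowerSeries.mk fun n => T (PowerSeries.coeff n f)) =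
      PowerSeries.mk fun n => ∑ p ∈ Finset.HasAntidiagonal.antidiagonal n,
        PowerSeries.coeff p.1 (a * φ (T (PowerSeries.coeff p.2 f))) := by
  ext1 n
  simp only [extendHom, RingHom.coe_mk, MonoidHom.coe_mk, OneHom.coe_mk, PowerSeries.coeff_mk,
    PowerSeries.coeff_mul, Finset.mul_sum]
  rw [Finset.sum_sigma', Finset.sum_sigma']
  refine Finset.sum_nbij' (fun x => ⟨(x.1.1 + x.2.1, x.2.2), (x.1.1, x.2.1)⟩)
    (fun x => ⟨(x.2.1, x.2.2 + x.1.2), (x.2.2, x.1.2)⟩) ?_ ?_ ?_ ?_ ?_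
  · rintro ⟨⟨a, b⟩, ⟨i, j⟩⟩ h
    simp at h ⊢
    omega
  · rintro ⟨⟨a, b⟩, ⟨i, j⟩⟩ h
    simp at h ⊢
    omega
  · rintro ⟨⟨a, b⟩, ⟨i, j⟩⟩ h
    simp at h ⊢
    omega
  · rintro ⟨⟨a, b⟩, ⟨i, j⟩⟩ h
    simp at h ⊢
    omega
  · rintro ⟨⟨a, b⟩, ⟨i, j⟩⟩ h
    rfl

/-- The first variation formula along a homomorphism $\varphi$ commuting with $\partial$. It is
stated in this generality to cover both the inclusion of jets and the involution. -/
theorem extendAdd_sub_mem_exact (hφ : ∀ x, φ (jetDer x) = totalDer (φ x)) {D : Jets →+ TodaAlg}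
    (hmul : ∀ x y, D (x * y) = φ x * D y + φ y * D x)
    (hC : ∀ c, D (MvPolynomial.C c) = 0) {a b : TodaAlg} (hq : D (X .q) = φ (X .q) * b)
    (hv : ∀ k, D (X (.v k)) = totalDer^[k] a) (hu : ∀ k, D (X (.u k)) = totalDer^[k] b)
    (f : TodaAlg) :
    extendAdd D f - (a * extendHom φ (varV (integral f)) + b * extendHom φ (varU (integral f)))
      ∈ exact jetDerRat := by
  have hV : varV (integral f) =
      PowerSeries.mk fun n => (byParts ∘ₗ gradV.toLinearMap) (PowerSeries.coeff n f) := rfl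
  have hU : varU (integral f) =
      PowerSeries.mk fun n => (byParts ∘ₗ gradU.toLinearMap) (PowerSeries.coeff n f) := rfl
  rw [hV, hU, mul_extendHom, mul_extendHom,
    mem_exact_iff_coeff]
  intro n
  rw [extendAdd, map_sub, map_add, PowerSeries.coeff_mk, PowerSeries.coeff_mk,
    PowerSeries.coeff_mk, ← Finset.sum_add_distrib, ← Finset.sum_sub_distrib]
  refine Submodule.sum_mem _ fun p _ => ?_
  rw [← map_add, ← map_sub]
  refine mem_exact_iff_coeff.1 ?_ p.1
  rw [eq_pairing hmul hC hq hv hu, add_sub_add_comm]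
  exact add_mem (pairing_sub_mem_exact hφ _ _) (pairing_sub_mem_exact hφ _ _)

end Pullback

end

end EqToda

namespace EqToda

/-! ### Evolutionary derivations, conjugation and the Hamiltonians -/

noncomputable section

open MvPolynomial (X)

/-! ### Evolutionary derivations -/

/-- The evolutionary derivation with characteristic `(g, h)`: it commutes with `∂`, and sends `v`
to `g` and `u` to `h`. -/
def evol (g h : Jets) : Derivation Constants Jets Jets :=
  MvPolynomial.mkDerivation Constants fun
    | .q => X .q * h
    | .v k => jetDer^[k] g
    | .u k => jetDer^[k] h

/-- The commutator of the two derivations is again a derivation, so it suffices that it vanishes on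
the generators. -/
theorem evol_jetDer (g h x : Jets) : evol g h (jetDer x) = jetDer (evol g h x) := by
  have : ⁅evol g h, jetDer⁆ = 0 := by
    refine MvPolynomial.derivation_ext fun i => ?_
    rw [Derivation.commutator_apply]
    cases i with
    | q =>
      simp [evol, jetDer, MvPolynomial.mkDerivation_X]
      ring
    | v k =>
      simp [evol, jetDer, MvPolynomial.mkDerivation_X, Function.iterate_succ_apply',
        -Function.iterate_succ]
    | u k =>
      simp [evol, jetDer, MvPolynomial.mkDerivation_X, Function.iterate_succ_apply',
        -Function.iterate_succ]
  have h1 := congrArg (fun D => D x) this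
  rw [Derivation.commutator_apply] at h1
  exact sub_eq_zero.1 h1

/-- `evol g h` as a derivation over `ℚ`. -/
def evolRat (g h : Jets) : Derivation ℚ Jets Jets := (evol g h).restrictScalars ℚ

theorem evolRat_comm (g h x : Jets) : evolRat g h (jetDerRat x) = jetDerRat (evolRat g h x) :=
  evol_jetDer g h x

theorem der_C {R : Type*} [CommRing R] [Algebra ℚ R] (δ : Derivation ℚ R R) (x : R) :
    der δ (PowerSeries.C x) = PowerSeries.C (δ x) := by
  ext n
  simp only [der, PowerSeries.coeff_mk, PowerSeries.coeff_C]
  split_ifs <;> simp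

theorem der_evolRat_jv (g h : Jets) : der (evolRat g h) jv = PowerSeries.C g := by
  rw [jv, der_C]
  exact congrArg _ (MvPolynomial.mkDerivation_X _ _ _)

theorem der_evolRat_ju (g h : Jets) : der (evolRat g h) ju = PowerSeries.C h := by
  rw [ju, der_C]
  exact congrArg _ (MvPolynomial.mkDerivation_X _ _ _)

theorem der_evolRat_jq (g h : Jets) : der (evolRat g h) jq = jq * PowerSeries.C h := by
  rw [jq, der_C, ← map_mul]
  exact congrArg _ (MvPolynomial.mkDerivation_X _ _ _)

theorem der_evolRat_smul (g h : Jets) (c : Constants) (f : TodaAlg) :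
    der (evolRat g h) (c • f) = c • der (evolRat g h) f := by
  ext1 n
  simp only [der, PowerSeries.coeff_mk, PowerSeries.coeff_smul]
  exact (evol g h).map_smul c _

theorem der_evolRat_const (g h : Jets) (c : Constants) :
    der (evolRat g h) (algebraMap Constants TodaAlg c) = 0 := by
  rw [Algebra.algebraMap_eq_smul_one, der_evolRat_smul, der_one, smul_zero]

theorem der_evolRat_iter (g h : Jets) (k : ℕ) (f : TodaAlg) :
    der (evolRat g h) (totalDer^[k] f) = totalDer^[k] (der (evolRat g h) f) := by
  induction k with
  | zero => rfl
  | succ k ih =>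
    rw [Function.iterate_succ_apply', Function.iterate_succ_apply', ← ih]
    exact der_der_comm (evolRat_comm g h) _

theorem sum_antidiagonal_coeff_C (T : ℕ → Jets) (n : ℕ) :
    ∑ p ∈ Finset.HasAntidiagonal.antidiagonal n,
      PowerSeries.coeff p.1 (PowerSeries.C (T p.2)) = T n := by
  rw [Finset.sum_eq_single (0, n)]
  · simp
  · rintro ⟨a, b⟩ hab hne
    have : a ≠ 0 := by
      rintro rfl
      simp at hab
      exact hne (by simp [hab])
    simp [PowerSeries.coeff_C, this]
  · simp

theorem coeff_extendHom {R S : Type*} [CommRing R] [CommRing S] (φ : R →+* S⟦X⟧) (f : R⟦X⟧)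
    (n : ℕ) : PowerSeries.coeff n (extendHom φ f) =
      ∑ p ∈ Finset.HasAntidiagonal.antidiagonal n,
        PowerSeries.coeff p.1 (φ (PowerSeries.coeff p.2 f)) := by
  simp [extendHom]

theorem extendHom_C (f : TodaAlg) : extendHom (PowerSeries.C : Jets →+* TodaAlg) f = f := by
  ext1 n
  rw [coeff_extendHom]
  exact sum_antidiagonal_coeff_C (fun m => PowerSeries.coeff m f) n

/-- The first variation formula. -/
theorem der_evolRat_sub_mem_exact (g h : Jets) (f : TodaAlg) :
    der (evolRat g h) f - (PowerSeries.C g * varV (integral f) +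
      PowerSeries.C h * varU (integral f)) ∈ exact jetDerRat := by
  have key := extendAdd_sub_mem_exact (φ := (PowerSeries.C : Jets →+* TodaAlg))
    (D := (PowerSeries.C : Jets →+* TodaAlg).toAddMonoidHom.comp
      (evol g h).toLinearMap.toAddMonoidHom)
    (a := PowerSeries.C g) (b := PowerSeries.C h)
    (fun x => (der_C jetDerRat x).symm) (fun x y => ?_) (fun c => ?_) ?_ (fun k => ?_)
    (fun k => ?_) f
  · rw [extendHom_C, extendHom_C] at key
    convert key using 2
    ext1 n
    rw [der, extendAdd, PowerSeries.coeff_mk, PowerSeries.coeff_mk]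
    exact (sum_antidiagonal_coeff_C (fun m => evol g h (PowerSeries.coeff m f)) n).symm
  · change PowerSeries.C (evol g h (x * y)) = _ * PowerSeries.C (evol g h y) +
      _ * PowerSeries.C (evol g h x)
    rw [Derivation.leibniz, map_add, smul_eq_mul, smul_eq_mul, map_mul, map_mul]
  · change PowerSeries.C (evol g h (algebraMap Constants Jets c)) = 0
    rw [Derivation.map_algebraMap, map_zero]
  · exact der_evolRat_jq g h ▸ (der_C (evolRat g h) (X .q)).symm
  · rw [← map_iter_jetDer fun x => (der_C jetDerRat x).symm]
    exact congrArg PowerSeries.C (MvPolynomial.mkDerivation_X _ _ _)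
  · rw [← map_iter_jetDer fun x => (der_C jetDerRat x).symm]
    exact congrArg PowerSeries.C (MvPolynomial.mkDerivation_X _ _ _)

/-- The first variation formula along the involution: $\bar v=v-\tau\mathsf Pu$ varies by
$g-\tau\mathsf Ph$, and $\bar u=u$ by $h$. -/
theorem der_evolRat_conj_sub_mem_exact (g h : Jets) (f : TodaAlg) :
    der (evolRat g h) (conj f) -
      ((PowerSeries.C g - tau • opPToda (PowerSeries.C h)) * conj (varV (integral f)) +
        PowerSeries.C h * conj (varU (integral f))) ∈ exact jetDerRat := by
  have key := extendAdd_sub_mem_exact (φ := conjJets)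
    (D := (derLin (evolRat g h)).toAddMonoidHom.comp conjJets.toAddMonoidHom)
    (a := PowerSeries.C g - tau • opPToda (PowerSeries.C h)) (b := PowerSeries.C h)
    conjJets_jetDer (fun x y => ?_) (fun c => ?_) ?_ (fun k => ?_)
    (fun k => ?_) f
  · refine Eq.mp (congrArg (· - _ ∈ exact jetDerRat) ?_) key
    ext1 n
    rw [extendAdd, PowerSeries.coeff_mk, der, PowerSeries.coeff_mk, conj, coeff_extendHom,
      map_sum]
    refine Finset.sum_congr rfl fun p _ => ?_
    change PowerSeries.coeff p.1 (der (evolRat g h) _) = _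
    rw [der, PowerSeries.coeff_mk]
    rfl
  · change der (evolRat g h) (conjJets (x * y)) = _ * der (evolRat g h) (conjJets y) +
      _ * der (evolRat g h) (conjJets x)
    rw [map_mul, der_mul]
    ring
  · change der (evolRat g h) (conjJets (MvPolynomial.C c)) = 0
    have : conjJets (MvPolynomial.C c) = algebraMap Constants TodaAlg (conjConst c) :=
      MvPolynomial.eval₂Hom_C _ _ _
    rw [this, der_evolRat_const]
  · change der (evolRat g h) (conjJets (X .q)) = _
    have : conjJets (X .q) = jq := MvPolynomial.eval₂Hom_X' _ _ _
    rw [this, der_evolRat_jq]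
  · change der (evolRat g h) (conjJets (X (.v k))) = _
    have : conjJets (X (.v k)) = totalDer^[k] (jv - tau • opPToda ju) :=
      MvPolynomial.eval₂Hom_X' _ _ _
    have hsub : ∀ a b : TodaAlg, der (evolRat g h) (a - b) =
        der (evolRat g h) a - der (evolRat g h) b := map_sub (derLin (evolRat g h))
    have hP : der (evolRat g h) (opPToda ju) = opPToda (der (evolRat g h) ju) :=
      der_op_comm (evolRat_comm g h) _ _
    rw [this, der_evolRat_iter, hsub, der_evolRat_smul, hP, der_evolRat_jv, der_evolRat_ju]
  · change der (evolRat g h) (conjJets (X (.u k))) = _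
    have : conjJets (X (.u k)) = totalDer^[k] ju := MvPolynomial.eval₂Hom_X' _ _ _
    rw [this, der_evolRat_iter, der_evolRat_ju]

/-! ### Variational derivatives of conjugates -/

theorem eq_zero_of_forall_C_mul_mem_exact {f : TodaAlg}
    (hf : ∀ g : Jets, PowerSeries.C g * f ∈ exact jetDerRat) : f = 0 := by
  ext1 n
  rw [map_zero]
  refine eq_zero_of_mul_mem_range fun g => ?_
  have := mem_exact_iff_coeff.1 (hf g) n
  rwa [PowerSeries.coeff_C_mul] at this

theorem eq_of_forall_evol {a b a' b' : TodaAlg} (hab : ∀ g h : Jets,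
    (PowerSeries.C g * a + PowerSeries.C h * b) - (PowerSeries.C g * a' + PowerSeries.C h * b') ∈
      exact jetDerRat) : a = a' ∧ b = b' := by
  refine ⟨sub_eq_zero.1 (eq_zero_of_forall_C_mul_mem_exact fun g => ?_),
    sub_eq_zero.1 (eq_zero_of_forall_C_mul_mem_exact fun h => ?_)⟩
  · simpa [mul_sub] using hab g 0
  · simpa [mul_sub] using hab 0 h

/-- Variational derivatives are recognized from the pairing with all characteristics.
Characteristics constant in $\varepsilon$ suffice, since exactness is tested one power of
$\varepsilon$ at a time. -/
theorem varV_varU_of_forall_evol {f a b : TodaAlg} (hf : ∀ g h : Jets,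
    der (evolRat g h) f - (PowerSeries.C g * a + PowerSeries.C h * b) ∈ exact jetDerRat) :
    varV (integral f) = a ∧ varU (integral f) = b := by
  refine eq_of_forall_evol fun g h => ?_
  have := sub_mem (hf g h) (der_evolRat_sub_mem_exact g h f)
  rwa [sub_sub_sub_cancel_left] at this

/-- Self-adjointness moves $\mathsf P$ from $h$ to $\overline{\delta_vf}$, which puts the term
$-\tau\mathsf P\,\overline{\delta_vf}$ into $\delta_u$. -/
theorem varV_varU_conj (f : TodaAlg) :
    varV (integral (conj f)) = conj (varV (integral f)) ∧
    varU (integral (conj f)) =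
      conj (varU (integral f)) - tau • opPToda (conj (varV (integral f))) := by
  refine varV_varU_of_forall_evol fun g h => ?_
  have h1 := der_evolRat_conj_sub_mem_exact g h f
  have h2 := const_mul_mem_exact (d := jetDerRat) (totalDer_const tau)
    (opP_mul_sub_mem_exact (d := jetDerRat) (PowerSeries.C h) (conj (varV (integral f))))
  convert sub_mem h1 h2 using 1
  simp only [Algebra.smul_def, opPToda]
  ring

theorem conj_jq : conj jq = jq := by
  ext1 n
  have hq : conjJets (X .q) = jq := MvPolynomial.eval₂Hom_X' _ _ _
  rw [conj, coeff_extendHom, Finset.sum_eq_single (n, 0)]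
  · rw [jq, PowerSeries.coeff_zero_C, hq]
    rfl
  · rintro ⟨a, b⟩ hab hne
    have : b ≠ 0 := by
      rintro rfl
      simp at hab
      exact hne (by simp [hab])
    simp [jq, PowerSeries.coeff_C, this]
  · simp

/-! ### The Hamiltonians -/

/-- The density of `H_n`. -/
def hamiltonianDensity (n : ℕ) : TodaAlg :=
  hamDensity (algebraMap Constants TodaAlg tau) (fun k => algebraMap Constants TodaAlg (zc k))
    lax n

theorem integral_powDensity (n : ℕ) : integral (powDensity lax n) = h n := by
  rw [powDensity, h, trace]
  exact map_rat_smul integral _ _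

theorem integral_hamiltonianDensity (n : ℕ) : integral (hamiltonianDensity n) = H n := by
  have hc : ∀ (c : Constants) (f : TodaAlg),
      integral (algebraMap Constants TodaAlg c * f) = c • integral f := fun c f => by
    rw [← Algebra.smul_def, map_smul]
  rw [hamiltonianDensity, hamDensity, H, map_add, map_sub, map_sum, hc, integral_powDensity]
  simp only [hc, integral_powDensity]
  split_ifs
  · rw [map_zero]
  · rw [integral_powDensity]

/-- Along the characteristic $(g,h)$ one has $\delta v=g$ and $\delta q=qh$; the latter is the
source of the factor $q$ in $\delta_u$. -/
theorem varV_varU_H (n : ℕ) : varV (H n) = p 0 n ∧ varU (H n) = jq * p 1 n := by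
  rw [← integral_hamiltonianDensity]
  refine varV_varU_of_forall_evol fun g h => ?_
  have key := der_hamDensity lax_isLax (totalDer_const tau) (fun k => totalDer_const (zc k))
    eq_zero_of_der_eq_zero_of_mem_exact (evolRat_comm g h) (der_evolRat_const g h tau)
    (fun k => der_evolRat_const g h (zc k)) n
  rw [der_evolRat_jv, der_evolRat_jq] at key
  have := (Submodule.Quotient.eq _).1 key
  rwa [mul_comm jq, mul_assoc] at this

end

end EqToda

theorem mainTheorem4 (n : ℕ) :
    EqToda.varV (EqToda.H n) = EqToda.p 0 n ∧
    EqToda.varU (EqToda.H n) = EqToda.jq * EqToda.p 1 n ∧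
    EqToda.varV (EqToda.Hbar n) = EqToda.pbar 0 n ∧
    EqToda.varU (EqToda.Hbar n) =
      EqToda.jq * EqToda.pbar 1 n - EqToda.tau • EqToda.opPToda (EqToda.pbar 0 n) := by
  obtain ⟨h1, h2⟩ := EqToda.varV_varU_H n
  obtain ⟨h3, h4⟩ := EqToda.varV_varU_conj (EqToda.hamiltonianDensity n)
  have hbar : EqToda.Hbar n = EqToda.integral (EqToda.conj (EqToda.hamiltonianDensity n)) := by
    rw [EqToda.Hbar, ← EqToda.integral_hamiltonianDensity]
    rfl
  rw [EqToda.integral_hamiltonianDensity] at h3 h4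
  refine ⟨h1, h2, ?_, ?_⟩
  · rw [hbar, h3, h1, EqToda.pbar]
  · rw [hbar, h4, h1, h2, map_mul, EqToda.conj_jq, EqToda.pbar, EqToda.pbar]
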